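/- Let $D$ be a countably infinite set. A set augmented finite automaton (SAFA) over $D$ is a tuple $M=(Q,\Sigma\times D,q_0,F,H,\delta)$ with a finite set $Q$ of states, a finite alphabet $\Sigma$, an initial state $q_0\in Q$, a set $F\subseteq Q$ of final states, a finite family $H$ of sets $h_1,\dots,h_{k}$ of data values, all empty at the beginning of a computation, and a transition relation $\delta\subseteq Q\times\Sigma\times C\times OP\times Q$, where $C=\{p(h_i),\,!p(h_i)\mid 1\le i\le k\}$ and $OP=\{-\}\cup\{\mathsf{ins}(h_i)\mid 1\le i\le k\}$. In state $q$, reading a pair $(a,d)\in\Sigma\times D$, the automaton may take a transition $(q,a,\alpha,\mathsf{op},q')\in\delta$ if $\alpha=p(h_i)$ and $d$ is currently in $h_i$, or $\alpha={!p(h_i)}$ and $d$ is currently not in $h_i$; it moves to $q'$ and, if $\mathsf{op}=\mathsf{ins}(h_j)$, inserts $d$ into $h_j$, while $\mathsf{op}=-$ leaves all sets unchanged. The language $L(M)\subseteq(\Sigma\times D)^*$ consists of the words that have a run from $q_0$ which consumes the whole word and ends in a state of $F$. Theorem. The universality problem for SAFA is undecidable: there is no algorithm which, given (a finite description of) a SAFA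 $M$ with alphabet $\Sigma$, decides whether $L(M)=(\Sigma\times D)^*$. -/

import Mathlib

/-- The conditions `C = {p(h), !p(h) | h ∈ H}`: the data value being read is (is not) in the
set named `h`. -/
inductive SAFA.Cond (H : Type*) where
  | mem (h : H)
  | notMem (h : H)

/-- The operations `OP = {-, ins(h) | h ∈ H}`: do nothing, or insert the data value being read
into the set named `h`. -/
inductive SAFA.Op (H : Type*) where
  | skip
  | ins (h : H)

/-- A (nondeterministic) set augmented finite automaton with states `Q`, attributes `A` and names
of sets `H`; these are finite in all uses. The data domain `D` plays no role in the description of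
the automaton and is an argument of its language. -/
structure SAFA (Q A H : Type*) where
  /-- the initial state -/
  start : Q
  /-- the final states -/
  final : Set Q
  /-- the transition relation -/
  trans : Set (Q × A × SAFA.Cond H × SAFA.Op H × Q)

namespace SAFA

/-- Truth of a condition when the sets have the contents `h` and `d` is being read. -/
def Cond.Holds {H D : Type*} (h : H → Set D) (d : D) : Cond H → Prop
  | .mem i => d ∈ h i
  | .notMem i => d ∉ h i

/-- The contents of the sets after an operation, when `d` is being read. -/
def Op.apply {H D : Type*} [DecidableEq H] (h : H → Set D) (d : D) : Op H → (H → Set D)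
  | .skip => h
  | .ins i => Function.update h i (insert d (h i))

/-- `M.Run q h w q' h'`: some run of `M` that starts in the configuration `(q, h)` consumes the
whole data word `w` and ends in the configuration `(q', h')`. -/
inductive Run {Q A H D : Type*} [DecidableEq H] (M : SAFA Q A H) :
    Q → (H → Set D) → List (A × D) → Q → (H → Set D) → Prop
  | nil (q : Q) (h : H → Set D) : Run M q h [] q h
  | cons {q r q' : Q} {h h' : H → Set D} {a : A} {d : D} {w : List (A × D)}
      {c : Cond H} {op : Op H} (ht : (q, a, c, op, r) ∈ M.trans) (hc : c.Holds h d)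
      (hrun : Run M r (op.apply h d) w q' h') : Run M q h ((a, d) :: w) q' h'

/-- The data language `L(M) ⊆ (A × D)^*`: the data words with a run from the initial state, all
sets being empty at first, to a final state. -/
def language {Q A H : Type*} [DecidableEq H] (M : SAFA Q A H) (D : Type*) : Language (A × D) :=
  {w | ∃ q ∈ M.final, ∃ h : H → Set D, M.Run M.start (fun _ => ∅) w q h}

/-- `L(M) = (A × D)^*`. -/
def IsUniversal {Q A H : Type*} [DecidableEq H] (M : SAFA Q A H) (D : Type*) : Prop :=
  M.language D = (Set.univ : Set (List (A × D)))

/-! ### Finite descriptions of automata, as inputs of algorithms -/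

/-- Transition with all of its parts written as numbers: source state, attribute, condition
(`(true, i)` for `p(hᵢ)` and `(false, i)` for `!p(hᵢ)`), operation (`none` for `-` and `some i`
for `ins(hᵢ)`), target state. -/
abbrev TransCode := ℕ × ℕ × (Bool × ℕ) × Option ℕ × ℕ

/-- Description of an automaton: numbers of states, attributes and sets, initial state, list of
the final states, list of the transitions. -/
abbrev Code := (ℕ × ℕ × ℕ) × ℕ × List ℕ × List TransCode

/-- A condition as numbers. -/
def Cond.code {k : ℕ} : Cond (Fin k) → Bool × ℕ
  | .mem i => (true, i)
  | .notMem i => (false, i)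

/-- An operation as numbers. -/
def Op.code {k : ℕ} : Op (Fin k) → Option ℕ
  | .skip => none
  | .ins i => some i

/-- A transition as numbers. -/
def transCode {n m k : ℕ} (t : Fin n × Fin m × Cond (Fin k) × Op (Fin k) × Fin n) : TransCode :=
  (t.1, t.2.1, t.2.2.1.code, t.2.2.2.1.code, t.2.2.2.2)

/-- `c` is a description of `M`; the two lists may be in any order. -/
def Describes {n m k : ℕ} (c : Code) (M : SAFA (Fin n) (Fin m) (Fin k)) : Prop :=
  ∃ (F : List ℕ) (T : List TransCode),
    c = ((n, m, k), (M.start : ℕ), F, T) ∧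
    (∀ q : ℕ, q ∈ F ↔ ∃ p ∈ M.final, (p : ℕ) = q) ∧
    (∀ t : TransCode, t ∈ T ↔ ∃ s ∈ M.trans, transCode s = t)

/-- The universality problem over the data domain `D` is decidable: some computable predicate on
descriptions answers correctly on every description of every automaton (with finitely many states,
attributes and sets). -/
def UniversalityDecidable (D : Type*) : Prop :=
  ∃ P : Code → Prop, ComputablePred P ∧
    ∀ (n m k : ℕ) (M : SAFA (Fin n) (Fin m) (Fin k)) (c : Code),
      Describes c M → (P c ↔ M.IsUniversal D)

end SAFA

/-! The halting problem reduces to non-universality. Take the actions of a counter machine as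
letters, each carrying a data value. A data word records a run if its actions are accepted by the
control, each increment carries a value new for its register, each decrement cancels the value of an
earlier increment, and no increment is left uncancelled at a zero test. Then the content of a
register is the number of its uncancelled values, so records and runs correspond
(`exec_of_faultless`, `exists_faultless_of_exec`).

A SAFA cannot check such records, but it can detect by nondeterminism that a word is not one.
Repeated increments, repeated decrements and decrements without increment are membership tests in
two sets per register. An increment uncancelled at a zero test is found by guessing it and storing
its value in one further set (`monitor_accepts_main`). Hence the monitor is universal exactly when
no accepting run exists (`monitor_isUniversal_iff`).

For the power of counter machines, programs are regular languages of actions: product and star serve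
as control structures, and closure of regular languages provides the finite control. All partial
recursive functions are computed in this way (`computes_partrec`), so one fixed control handles all
instances of the halting problem (`exists_dfa_of_partrec`). The instance `n` enters through a chain
of `n` increments in front of that control, which keeps the descriptions primitive recursive in `n`
(`exists_primrec_describes`). -/

namespace Language

/-! ### Closure of regular languages under product and star. -/

open scoped Computability

variable {α : Type*}

/-- In a factorisation of `x ++ y`, the cut falls either in `y` or in `x`. The right side depends
only on one quotient of `L` and a set of quotients of `M`, so finiteness is inherited. -/
theorem leftQuotient_mul (L M : Language α) (x : List α) :
    (L * M).leftQuotient x =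
      L.leftQuotient x * M + sSup (M.leftQuotient '' {u | ∃ v ∈ L, v ++ u = x}) := by
  ext y
  rw [mem_leftQuotient, mem_add, mem_mul, mem_mul]
  have key : y ∈ sSup (M.leftQuotient '' {u | ∃ v ∈ L, v ++ u = x}) ↔
      ∃ v ∈ L, ∃ u, v ++ u = x ∧ u ++ y ∈ M := by
    rw [sSup_image]
    simp only [mem_iSup, Set.mem_ofPred_eq, mem_leftQuotient]
    aesop
  rw [key]
  constructor
  · rintro ⟨a, ha, c, hc, h⟩
    rcases List.append_eq_append_iff.1 h with ⟨z, rfl, rfl⟩ | ⟨z, rfl, rfl⟩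
    · exact .inr ⟨a, ha, z, rfl, hc⟩
    · exact .inl ⟨z, ha, c, hc, rfl⟩
  · rintro (⟨z, hz, c, hc, rfl⟩ | ⟨v, hv, u, rfl, hu⟩)
    · exact ⟨x ++ z, hz, c, hc, by simp⟩
    · exact ⟨v, hv, u ++ y, hu, by simp⟩

/-- Consider the block of the factorisation that straddles the end of `x`: `v` collects the blocks
before it and `u` is its part inside `x`. If no block straddles, both `x` and `y` lie in `L∗`. The
last supremum is `L∗` or `0`, written so as to depend on a subset of `{L∗}`. -/
theorem leftQuotient_kstar (L : Language α) (x : List α) :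
    L∗.leftQuotient x =
      sSup (L.leftQuotient '' {u | ∃ v ∈ L∗, v ++ u = x}) * L∗ + sSup {M | M = L∗ ∧ x ∈ L∗} := by
  ext y
  rw [mem_leftQuotient, mem_add, mem_mul]
  have key (z : List α) : z ∈ sSup (L.leftQuotient '' {u | ∃ v ∈ L∗, v ++ u = x}) ↔
      ∃ v ∈ L∗, ∃ u, v ++ u = x ∧ u ++ z ∈ L := by
    rw [sSup_image]
    simp only [mem_iSup, Set.mem_ofPred_eq, mem_leftQuotient]
    aesop
  have key' : y ∈ sSup {M | M = L∗ ∧ x ∈ L∗} ↔ x ∈ L∗ ∧ y ∈ L∗ := by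
    rw [sSup_eq_iSup]
    simp only [mem_iSup, Set.mem_ofPred_eq]
    aesop
  have mul_mem {a b : List α} (ha : a ∈ L∗) (hb : b ∈ L∗) : a ++ b ∈ L∗ := by
    rw [← kstar_mul_kstar]
    exact append_mem_mul ha hb
  have of_mem {a : List α} (ha : a ∈ L) : a ∈ L∗ := mem_kstar.2 ⟨[a], by simp, by simpa⟩
  simp only [key, key']
  constructor
  · intro h
    obtain ⟨S, hS, hL⟩ := mem_kstar.1 h
    clear h key key'
    induction S generalizing x with
    | nil =>
      obtain ⟨rfl, rfl⟩ := List.append_eq_nil_iff.1 hS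
      exact .inr ⟨nil_mem_kstar L, nil_mem_kstar L⟩
    | cons l S ih =>
      rw [List.flatten_cons] at hS
      have hl : l ∈ L := hL l (by simp)
      have hS' : ∀ z ∈ S, z ∈ L := fun z hz => hL z (by simp [hz])
      rcases List.append_eq_append_iff.1 hS with ⟨z, rfl, rfl⟩ | ⟨z, rfl, hz⟩
      · exact .inl ⟨z, ⟨[], nil_mem_kstar L, x, rfl, hl⟩, _, mem_kstar.2 ⟨S, rfl, hS'⟩, rfl⟩
      · rcases ih z hz.symm hS' with ⟨a, ⟨v, hv, u, rfl, hu⟩, c, hc, rfl⟩ | ⟨hz, hy⟩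
        · exact .inl ⟨a, ⟨l ++ v, mul_mem (of_mem hl) hv, u, by simp, hu⟩, c, hc, rfl⟩
        · exact .inr ⟨mul_mem (of_mem hl) hz, hy⟩
  · rintro (⟨a, ⟨v, hv, u, rfl, hu⟩, c, hc, rfl⟩ | ⟨hx, hy⟩)
    · simpa using mul_mem (mul_mem hv (of_mem hu)) hc
    · exact mul_mem hx hy

/-- Myhill–Nerode: regularity means finitely many left quotients, and `leftQuotient_mul` leaves
finitely many choices. -/
theorem IsRegular.mul {L M : Language α} (hL : L.IsRegular) (hM : M.IsRegular) :
    (L * M).IsRegular := by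
  rw [isRegular_iff_finite_range_leftQuotient] at *
  refine ((hL.prod hM.finite_subsets).image fun p => p.1 * M + sSup p.2).subset ?_
  rintro _ ⟨x, rfl⟩
  exact ⟨(L.leftQuotient x, _), ⟨⟨x, rfl⟩, Set.image_subset_range _ _⟩,
    (leftQuotient_mul L M x).symm⟩

theorem IsRegular.kstar {L : Language α} (hL : L.IsRegular) : L∗.IsRegular := by
  rw [isRegular_iff_finite_range_leftQuotient] at *
  refine ((hL.finite_subsets.prod (Set.finite_singleton L∗).finite_subsets).image
    fun p => sSup p.1 * L∗ + sSup p.2).subset ?_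
  rintro _ ⟨x, rfl⟩
  exact ⟨(_, _), ⟨Set.image_subset_range _ _, fun M hM => hM.1⟩, (leftQuotient_kstar L x).symm⟩

theorem isRegular_singleton (w : List α) : IsRegular ({w} : Set (List α)) := by
  refine .of_finite_range_leftQuotient ?_
  refine (((w.tails.finite_toSet).image fun z => (({z} : Set (List α)) : Language α)).insert
    (0 : Language α)).subset ?_
  rintro _ ⟨x, rfl⟩
  by_cases h : ∃ z, x ++ z = w
  · obtain ⟨z, rfl⟩ := h
    refine .inr ⟨z, by simp, ?_⟩
    ext y
    exact ⟨fun h => congrArg _ h, fun h => List.append_cancel_left h⟩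
  · refine .inl (ext fun y => ⟨fun hy => (h ⟨y, hy⟩).elim, fun hy => (notMem_zero y hy).elim⟩)

end Language

/-! ### Counter machine programs as languages of actions. -/

/-- The actions of a counter machine with registers named by `R`. -/
inductive CounterAct (R : Type*) where
  | inc (r : R)
  | dec (r : R)
  | zero (r : R)
  deriving DecidableEq, Fintype

namespace CounterAct

open scoped Computability

section Exec

variable {R : Type*} [DecidableEq R]

/-- The register an action refers to. -/
def reg : CounterAct R → R
  | .inc r => r
  | .dec r => r
  | .zero r => r

/-- The effect of an action: decrements need a positive register, `zero r` tests that `r` is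
empty. -/
def Step : CounterAct R → (R → ℕ) → (R → ℕ) → Prop
  | .inc r, s, s' => s' = Function.update s r (s r + 1)
  | .dec r, s, s' => 0 < s r ∧ s' = Function.update s r (s r - 1)
  | .zero r, s, s' => s r = 0 ∧ s' = s

/-- The effect of a sequence of actions. -/
def Exec : List (CounterAct R) → (R → ℕ) → (R → ℕ) → Prop
  | [], s, s' => s' = s
  | a :: w, s, s' => ∃ t, a.Step s t ∧ Exec w t s'

theorem exec_append {u v : List (CounterAct R)} {s s' : R → ℕ} :
    Exec (u ++ v) s s' ↔ ∃ t, Exec u s t ∧ Exec v t s' := by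
  induction u generalizing s with
  | nil => simp [Exec]
  | cons a u ih =>
    simp only [List.cons_append, Exec, ih]
    exact ⟨fun ⟨t, h, t', h', h''⟩ => ⟨t', ⟨t, h, h'⟩, h''⟩,
      fun ⟨t', ⟨t, h, h'⟩, h''⟩ => ⟨t, h, t', h', h''⟩⟩

/-- The effect of a language of action sequences, read as a nondeterministic program. -/
def Rel (L : Language (CounterAct R)) (s s' : R → ℕ) : Prop :=
  ∃ w ∈ L, Exec w s s'

/-- The program performing a single action. -/
def act (a : CounterAct R) : Language (CounterAct R) := ({[a]} : Set _)

theorem rel_act {a : CounterAct R} {s s' : R → ℕ} : Rel (act a) s s' ↔ a.Step s s' := by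
  constructor
  · rintro ⟨w, rfl, t, h, rfl⟩
    exact h
  · exact fun h => ⟨[a], rfl, s', h, rfl⟩

theorem rel_one {s s' : R → ℕ} : Rel (1 : Language (CounterAct R)) s s' ↔ s' = s :=
  ⟨by rintro ⟨w, rfl, h⟩; exact h, fun h => ⟨[], Language.nil_mem_one, h⟩⟩

theorem rel_mul {L M : Language (CounterAct R)} {s s' : R → ℕ} :
    Rel (L * M) s s' ↔ ∃ t, Rel L s t ∧ Rel M t s' := by
  constructor
  · rintro ⟨w, hw, h⟩
    obtain ⟨u, hu, v, hv, rfl⟩ := Language.mem_mul.1 hw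
    obtain ⟨t, h, h'⟩ := exec_append.1 h
    exact ⟨t, ⟨u, hu, h⟩, v, hv, h'⟩
  · rintro ⟨t, ⟨u, hu, h⟩, v, hv, h'⟩
    exact ⟨u ++ v, Language.append_mem_mul hu hv, exec_append.2 ⟨t, h, h'⟩⟩

theorem rel_inc_mul {r : R} {M : Language (CounterAct R)} {s s' : R → ℕ} :
    Rel (act (.inc r) * M) s s' ↔ Rel M (Function.update s r (s r + 1)) s' := by
  simp [rel_mul, rel_act, Step]

theorem rel_dec_mul {r : R} {M : Language (CounterAct R)} {s s' : R → ℕ} :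
    Rel (act (.dec r) * M) s s' ↔ 0 < s r ∧ Rel M (Function.update s r (s r - 1)) s' := by
  simp [rel_mul, rel_act, Step, and_assoc]

theorem rel_zero_mul {r : R} {M : Language (CounterAct R)} {s s' : R → ℕ} :
    Rel (act (.zero r) * M) s s' ↔ s r = 0 ∧ Rel M s s' := by
  simp [rel_mul, rel_act, Step, and_assoc]

/-- Although programs are nondeterministic, most building blocks have exactly one outcome; this
allows a composite program to be evaluated by rewriting. -/
theorem rel_mul_of_iff {L M : Language (CounterAct R)} {s t s' : R → ℕ}
    (h : ∀ u, Rel L s u ↔ u = t) : Rel (L * M) s s' ↔ Rel M t s' := by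
  simp [rel_mul, h]

theorem rel_kstar {L : Language (CounterAct R)} {s s' : R → ℕ} :
    Rel L∗ s s' ↔ Relation.ReflTransGen (Rel L) s s' := by
  constructor
  · rintro ⟨w, hw, h⟩
    obtain ⟨S, rfl, hS⟩ := Language.mem_kstar.1 hw
    clear hw
    induction S generalizing s with
    | nil =>
      obtain rfl : s' = s := h
      exact .refl
    | cons l S ih =>
      obtain ⟨t, h, h'⟩ := exec_append.1 (List.flatten_cons ▸ h)
      exact .head ⟨l, hS l (by simp), h⟩ (ih (fun y hy => hS y (by simp [hy])) h')
  · intro h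
    induction h using Relation.ReflTransGen.head_induction_on with
    | refl => exact ⟨[], Language.nil_mem_kstar L, rfl⟩
    | head h _ ih =>
      obtain ⟨u, hu, h⟩ := h
      obtain ⟨v, hv, h'⟩ := ih
      obtain ⟨S, rfl, hS⟩ := Language.mem_kstar.1 hv
      refine ⟨u ++ S.flatten, Language.mem_kstar.2 ⟨u :: S, by simp, ?_⟩, exec_append.2 ⟨_, h, h'⟩⟩
      rintro y (_ | ⟨_, hy⟩)
      exacts [hu, hS y hy]

/-- A loop whose body follows the trajectory `G` as long as the condition `c` holds. -/
theorem rel_kstar_of_trajectory {L : Language (CounterAct R)} (G : ℕ → R → ℕ) (c : ℕ → Prop)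
    (h : ∀ k t, Rel L (G k) t ↔ c k ∧ t = G (k + 1)) {t : R → ℕ} :
    Rel L∗ (G 0) t ↔ ∃ N, (∀ k < N, c k) ∧ t = G N := by
  rw [rel_kstar]
  constructor
  · intro h'
    induction h' with
    | refl => exact ⟨0, by simp, rfl⟩
    | tail _ hstep ih =>
      obtain ⟨N, hN, rfl⟩ := ih
      obtain ⟨hc, rfl⟩ := (h _ _).1 hstep
      exact ⟨N + 1, fun k hk => (Nat.lt_succ_iff_lt_or_eq.1 hk).elim (hN k) (· ▸ hc), rfl⟩
  · rintro ⟨N, hN, rfl⟩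
    induction N with
    | zero => exact .refl
    | succ N ih =>
      exact (ih fun k hk => hN k (by omega)).tail ((h _ _).2 ⟨hN N (by omega), rfl⟩)

/-- A loop that is run until the register `r` is empty. -/
theorem rel_while {L : Language (CounterAct R)} {r : R} (G : ℕ → R → ℕ) (n : ℕ)
    (hr : ∀ k, G k r = n - k) (h : ∀ k t, Rel L (G k) t ↔ k < n ∧ t = G (k + 1)) {t : R → ℕ} :
    Rel (L∗ * act (.zero r)) (G 0) t ↔ t = G n := by
  simp only [rel_mul, rel_act, rel_kstar_of_trajectory G _ h, Step]
  constructor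
  · rintro ⟨_, ⟨N, hN, rfl⟩, h0, rfl⟩
    rw [hr] at h0
    -- The zero test discards early exits (`N < n`), and `n < N` would need a round whose guard is
    -- `n < n`.
    obtain rfl | hlt : N = n ∨ n < N := by omega
    · rfl
    · exact absurd (hN n hlt) (lt_irrefl _)
  · rintro rfl
    exact ⟨_, ⟨n, fun k hk => hk, rfl⟩, by simp [hr], rfl⟩

/-- Regular programs using finitely many registers. -/
structure IsProg (L : Language (CounterAct ℕ)) : Prop where
  regular : L.IsRegular
  bounded : ∃ K, ∀ w ∈ L, ∀ a ∈ w, a.reg < K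

theorem isProg_act (a : CounterAct ℕ) : IsProg (act a) :=
  ⟨Language.isRegular_singleton _, a.reg + 1, by rintro _ rfl; simp⟩

theorem isProg_one : IsProg 1 :=
  ⟨Language.isRegular_singleton _, 0, by rintro _ rfl; simp⟩

theorem IsProg.mul {L M : Language (CounterAct ℕ)} (hL : IsProg L) (hM : IsProg M) :
    IsProg (L * M) := by
  obtain ⟨hL, K, hK⟩ := hL
  obtain ⟨hM, K', hK'⟩ := hM
  refine ⟨hL.mul hM, max K K', fun w hw a ha => ?_⟩
  obtain ⟨u, hu, v, hv, rfl⟩ := Language.mem_mul.1 hw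
  rcases List.mem_append.1 ha with ha | ha
  · exact lt_max_of_lt_left (hK u hu a ha)
  · exact lt_max_of_lt_right (hK' v hv a ha)

theorem IsProg.kstar {L : Language (CounterAct ℕ)} (hL : IsProg L) : IsProg L∗ := by
  obtain ⟨hL, K, hK⟩ := hL
  refine ⟨hL.kstar, K, fun w hw a ha => ?_⟩
  obtain ⟨S, rfl, hS⟩ := Language.mem_kstar.1 hw
  obtain ⟨l, hl, ha⟩ := List.mem_flatten.1 ha
  exact hK l (hS l hl) a ha

end Exec

/-! ### Basic register programs. -/

/-- Empty a register. -/
def clear (r : ℕ) : Language (CounterAct ℕ) := (act (.dec r))∗ * act (.zero r)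

theorem isProg_clear (r : ℕ) : IsProg (clear r) := (isProg_act _).kstar.mul (isProg_act _)

theorem rel_clear {r : ℕ} {s t : ℕ → ℕ} :
    Rel (clear r) s t ↔ t = Function.update s r 0 := by
  have := rel_while (L := act (.dec r)) (r := r) (fun k => Function.update s r (s r - k)) (s r)
    (by simp) (t := t) fun k t => by
      simp only [rel_act, Step, Function.update_self, Function.update_idem, Nat.sub_sub]
      rw [Nat.sub_pos_iff_lt]
  simpa [clear] using this

/-- Add the register `r` to the register `o`, emptying `r`. -/
def move (r o : ℕ) : Language (CounterAct ℕ) :=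
  (act (.dec r) * act (.inc o))∗ * act (.zero r)

theorem isProg_move (r o : ℕ) : IsProg (move r o) :=
  ((isProg_act _).mul (isProg_act _)).kstar.mul (isProg_act _)

theorem rel_move {r o : ℕ} (h : r ≠ o) {s t : ℕ → ℕ} :
    Rel (move r o) s t ↔ t = Function.update (Function.update s r 0) o (s o + s r) := by
  have := rel_while (L := act (.dec r) * act (.inc o)) (r := r)
    (fun k => Function.update (Function.update s r (s r - k)) o (s o + k)) (s r)
    (by simp [h]) (t := t) fun k t => by
      simp only [rel_dec_mul, rel_act, Step]
      refine and_congr (by simp [h]) (Eq.congr_right ?_)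
      ext i
      simp only [Function.update_apply]
      grind
  simpa [move] using this

/-- Add the register `r` to the register `o`, using `t` as an auxiliary register. -/
def copy (r o t : ℕ) : Language (CounterAct ℕ) :=
  (move r t) * ((act (.dec t) * (act (.inc r) * act (.inc o)))∗ * act (.zero t))

theorem isProg_copy (r o t : ℕ) : IsProg (copy r o t) :=
  (isProg_move r t).mul (((isProg_act _).mul ((isProg_act _).mul (isProg_act _))).kstar.mul
    (isProg_act _))

theorem rel_copy {r o x : ℕ} (hr : r ≠ x) (ho : o ≠ x) {s t : ℕ → ℕ} (hx : s x = 0) :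
    Rel (copy r o x) s t ↔ t = Function.update s o (s o + s r) := by
  rw [copy, rel_mul_of_iff fun u => rel_move hr]
  have := rel_while (L := act (.dec x) * (act (.inc r) * act (.inc o))) (r := x)
    -- The sum keeps this correct when `r = o`, where each round adds two to the same register.
    (fun k i => (if i = x then s r - k else if i = r then k else s i) + if i = o then k else 0)
    (s r)
    (by simp [ho.symm]) (t := t) fun k t => by
      simp only [rel_dec_mul, rel_inc_mul, rel_act, Step]
      refine and_congr (by simp [ho.symm]) (Eq.congr_right ?_)
      ext i
      simp only [Function.update_apply]
      grind
  convert this using 2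
  · ext i
    simp only [Function.update_apply]
    grind
  · ext i
    simp only [Function.update_apply]
    grind

end CounterAct

/-! ### Counter machines compute all partial recursive functions. -/

namespace CounterAct

open scoped Computability

/-- The function `f` is computed by counter machines: for all choices of input registers and an
output register below `b`, some program whose work registers are those from `b` on adds the value
to the output register, leaving everything else as it was. -/
def Computes {n : ℕ} (f : List.Vector ℕ n →. ℕ) : Prop :=
  ∀ (ins : Fin n → ℕ) (o b : ℕ), (∀ i, ins i < b) → o < b → ∃ L, IsProg L ∧
    ∀ s t : ℕ → ℕ, (∀ i, b ≤ i → s i = 0) →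
      (Rel L s t ↔ ∃ y ∈ f (List.Vector.ofFn fun i => s (ins i)),
        t = Function.update s o (s o + y))

/-- The registers from `d` on are overwritten by the entries of a list. -/
def write (s : ℕ → ℕ) : ℕ → List ℕ → ℕ → ℕ
  | _, [] => s
  | d, y :: l => write (Function.update s d y) (d + 1) l

theorem write_of_lt {l : List ℕ} {s : ℕ → ℕ} {d i : ℕ} (h : i < d) : write s d l i = s i := by
  induction l generalizing s d with
  | nil => rfl
  | cons y l ih => rw [write, ih (by omega), Function.update_of_ne (by omega)]

theorem write_of_ge {l : List ℕ} {s : ℕ → ℕ} {d i : ℕ} (h : d + l.length ≤ i) :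
    write s d l i = s i := by
  induction l generalizing s d with
  | nil => rfl
  | cons y l ih =>
    rw [List.length_cons] at h
    rw [write, ih (by omega), Function.update_of_ne (by omega)]

theorem write_getElem {l : List ℕ} {s : ℕ → ℕ} {d i : ℕ} (h : i < l.length) :
    write s d l (d + i) = l[i] := by
  induction l generalizing s d i with
  | nil => simp at h
  | cons y l ih =>
    cases i with
    | zero => simp [write, write_of_lt]
    | succ i =>
      have := ih (s := Function.update s d y) (d := d + 1) (i := i) (by simpa using h)
      rw [write, ← add_assoc, add_right_comm, this]
      simp

theorem write_append_zero {l : List ℕ} {s : ℕ → ℕ} {d : ℕ} (h : ∀ i, d ≤ i → s i = 0) :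
    ∀ i, d + l.length ≤ i → write s d l i = 0 := fun i hi => by
  rw [write_of_ge hi, h i (by omega)]

/-- Several functions can be computed into consecutive registers. -/
theorem Computes.mOfFn {n m : ℕ} {g : Fin m → List.Vector ℕ n →. ℕ} (hg : ∀ i, Computes (g i))
    (ins : Fin n → ℕ) (d b : ℕ) (hins : ∀ i, ins i < d) (hb : d + m ≤ b) :
    ∃ L, IsProg L ∧ ∀ s t : ℕ → ℕ, (∀ i, d ≤ i → s i = 0) →
      (Rel L s t ↔ ∃ ys ∈ List.Vector.mOfFn fun i => g i (List.Vector.ofFn fun i => s (ins i)),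
        t = write s d ys.toList) := by
  suffices ∃ L, IsProg L ∧ ∀ s t : ℕ → ℕ, (∀ i, b ≤ i → s i = 0) →
      (∀ i, d ≤ i → s i = 0) →
      (Rel L s t ↔ ∃ ys ∈ List.Vector.mOfFn fun i => g i (List.Vector.ofFn fun i => s (ins i)),
        t = write s d ys.toList) by
    obtain ⟨L, hL, h⟩ := this
    exact ⟨L, hL, fun s t hs => h s t (fun i hi => hs i (by omega)) hs⟩
  induction m generalizing d with
  | zero =>
    refine ⟨1, isProg_one, fun s t _ _ => ?_⟩
    simp [rel_one, List.Vector.mOfFn, write]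
  | succ m ih =>
    -- All components share the work area from `b` on, above every output register; each leaves it
    -- empty for the next.
    obtain ⟨L, hL, h⟩ := hg 0 ins d b (fun i => (hins i).trans (by omega)) (by omega)
    obtain ⟨M, hM, h'⟩ := ih (fun i => hg i.succ) (d + 1) (fun i => (hins i).trans (by omega))
      (by omega)
    refine ⟨L * M, hL.mul hM, fun s t hs hs' => ?_⟩
    have hup (y : ℕ) (i : Fin n) : Function.update s d y (ins i) = s (ins i) :=
      Function.update_of_ne (hins i).ne _ _
    have hM' (y : ℕ) := h' (Function.update s d y) t
      (fun i hi => by rw [Function.update_of_ne (by omega), hs i hi])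
      (fun i hi => by rw [Function.update_of_ne (by omega), hs' i (by omega)])
    simp only [hup] at hM'
    simp only [rel_mul, h s _ hs, hs' d le_rfl, zero_add]
    simp only [List.Vector.mOfFn, Part.bind_eq_bind, Part.pure_eq_some, Part.mem_bind_iff,
      Part.mem_some_iff]
    constructor
    · rintro ⟨_, ⟨y, hy, rfl⟩, hr⟩
      obtain ⟨ys, hys, rfl⟩ := (hM' y).1 hr
      exact ⟨y ::ᵥ ys, ⟨y, hy, ys, hys, rfl⟩, by simp [write]⟩
    · rintro ⟨_, ⟨y, hy, ys, hys, rfl⟩, rfl⟩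
      exact ⟨_, ⟨y, hy, rfl⟩, (hM' y).2 ⟨ys, hys, by simp [write]⟩⟩

/-- Consecutive registers can be emptied. -/
theorem exists_clear_range (d m : ℕ) : ∃ L, IsProg L ∧ ∀ s t : ℕ → ℕ,
    Rel L s t ↔ t = fun i => if d ≤ i ∧ i < d + m then 0 else s i := by
  induction m with
  | zero => exact ⟨1, isProg_one, fun s t => by
    rw [rel_one]
    refine Eq.congr_right (funext fun i => ?_)
    rw [if_neg (by omega)]⟩
  | succ m ih =>
    obtain ⟨L, hL, h⟩ := ih
    refine ⟨L * clear (d + m), hL.mul (isProg_clear _), fun s t => ?_⟩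
    rw [rel_mul_of_iff (h s), rel_clear]
    refine Eq.congr_right ?_
    ext i
    simp only [Function.update_apply]
    grind

/-- The intermediate values occupy the registers from `b` to `b + n - 1`, and `f` works from `b + n`
on. They are cleared at the end because a program must restore its work registers. -/
theorem Computes.comp {m n : ℕ} {f : List.Vector ℕ n →. ℕ} {g : Fin n → List.Vector ℕ m →. ℕ}
    (hf : Computes f) (hg : ∀ i, Computes (g i)) :
    Computes fun v => (List.Vector.mOfFn fun i => g i v).bind f := by
  intro ins o b hins ho
  obtain ⟨L, hL, h⟩ := Computes.mOfFn hg ins b (b + n) hins le_rfl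
  obtain ⟨M, hM, h'⟩ := hf (fun i => b + i) o (b + n) (by simp) (by omega)
  obtain ⟨C, hC, hc⟩ := exists_clear_range b n
  refine ⟨L * (M * C), hL.mul (hM.mul hC), fun s t hs => ?_⟩
  have hw (ys : List.Vector ℕ n) :
      List.Vector.ofFn (fun i : Fin n => write s b ys.toList (b + i)) = ys := by
    ext i
    rw [List.Vector.get_ofFn, write_getElem (by simp), List.Vector.get_eq_get_toList]
    rfl
  have hz (ys : List.Vector ℕ n) (i) (hi : b + n ≤ i) : write s b ys.toList i = 0 :=
    write_append_zero hs i (by simpa using hi)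
  have hclean (ys : List.Vector ℕ n) (y : ℕ) :
      (fun i => if b ≤ i ∧ i < b + n then 0 else
        Function.update (write s b ys.toList) o (write s b ys.toList o + y) i) =
      Function.update s o (s o + y) := by
    ext i
    rw [write_of_lt ho]
    simp only [Function.update_apply]
    split_ifs with h1 h2 h2
    · omega
    · rw [hs i h1.1]
    · rfl
    · rcases lt_or_ge i b with h3 | h3
      · exact write_of_lt h3
      · rw [hz ys i (by omega), hs i h3]
  have hbind (y : ℕ) {x : Part (List.Vector ℕ n)} : y ∈ x.bind f ↔ ∃ ys ∈ x, y ∈ f ys :=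
    Part.mem_bind_iff
  simp only [rel_mul, h s _ hs, hc, hbind]
  constructor
  · rintro ⟨_, ⟨ys, hys, rfl⟩, u, hr, rfl⟩
    rw [h' _ _ (hz ys), hw] at hr
    obtain ⟨y, hy, rfl⟩ := hr
    exact ⟨y, ⟨ys, hys, hy⟩, hclean ys y⟩
  · rintro ⟨y, ⟨ys, hys, hy⟩, rfl⟩
    exact ⟨_, ⟨ys, hys, rfl⟩, _, (h' _ _ (hz ys)).2 ⟨y, by rwa [hw], rfl⟩, (hclean ys y).symm⟩

theorem computes_zero : Computes (n := 0) fun _ => Part.some 0 :=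
  fun _ o _ _ _ => ⟨1, isProg_one, fun s t _ => by simp [rel_one]⟩

theorem computes_get {n : ℕ} (i : Fin n) :
    Computes fun v : List.Vector ℕ n => Part.some (v.get i) :=
  fun ins o b hins ho => ⟨copy (ins i) o b, isProg_copy _ _ _, fun s t hs => by
    rw [rel_copy (hins i).ne ho.ne (hs b le_rfl)]
    simp⟩

theorem computes_succ :
    Computes fun v : List.Vector ℕ 1 => Part.some v.head.succ :=
  fun ins o b hins ho => ⟨copy (ins 0) o b * act (.inc o),
    (isProg_copy _ _ _).mul (isProg_act _), fun s t hs => by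
    rw [rel_mul_of_iff fun u => rel_copy (hins 0).ne ho.ne (hs b le_rfl), rel_act, Step]
    simp [add_assoc]⟩

theorem Computes.rel_iff {n : ℕ} {f : List.Vector ℕ n → ℕ} (hf : Computes fun v => Part.some (f v))
    (ins : Fin n → ℕ) (o b : ℕ) (hins : ∀ i, ins i < b) (ho : o < b) :
    ∃ L, IsProg L ∧ ∀ s t : ℕ → ℕ, (∀ i, b ≤ i → s i = 0) →
      (Rel L s t ↔ t = Function.update s o (s o + f (List.Vector.ofFn fun i => s (ins i)))) := by
  obtain ⟨L, hL, h⟩ := hf ins o b hins ho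
  exact ⟨L, hL, fun s t hs => by simp [h s t hs]⟩

/-- Register `b` counts the remaining rounds, `b + 1` the completed ones, `b + 2` holds the current
value and `b + 3` receives the next one; the subprograms work from `b + 4` on. -/
theorem computes_prec {n : ℕ} {f : List.Vector ℕ n → ℕ} {g : List.Vector ℕ (n + 2) → ℕ}
    (hf : Computes fun v => Part.some (f v)) (hg : Computes fun v => Part.some (g v)) :
    Computes fun v : List.Vector ℕ (n + 1) =>
      Part.some (v.head.rec (f v.tail) fun y IH => g (y ::ᵥ IH ::ᵥ v.tail)) := by
  intro ins o b hins ho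
  have htail (i : Fin n) := hins i.succ
  obtain ⟨F, hF, hf⟩ := hf.rel_iff (fun i => ins i.succ) (b + 2) (b + 4)
    (fun i => (htail i).trans (by omega)) (by omega)
  obtain ⟨S, hS, hg⟩ := hg.rel_iff (Fin.cons (b + 1) (Fin.cons (b + 2) fun i => ins i.succ))
    (b + 3) (b + 4)
    (Fin.cases (by simp) (Fin.cases (by simp) fun i => (htail i).trans (by simp))) (by omega)
  refine ⟨copy (ins 0) b (b + 4) * (F * (((act (.dec b) * (S * (clear (b + 2) *
      (move (b + 3) (b + 2) * act (.inc (b + 1))))))∗ * act (.zero b)) *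
      (clear (b + 1) * move (b + 2) o))),
    (isProg_copy _ _ _).mul (hF.mul ((((isProg_act _).mul (hS.mul ((isProg_clear _).mul
      ((isProg_move _ _).mul (isProg_act _))))).kstar.mul (isProg_act _)).mul
      ((isProg_clear _).mul (isProg_move _ _)))), fun s t hs => ?_⟩
  set v : List.Vector ℕ n := List.Vector.ofFn fun i => s (ins i.succ) with hv
  set N := s (ins 0) with hN
  set r : ℕ → ℕ := fun k => k.rec (f v) fun y IH => g (y ::ᵥ IH ::ᵥ v) with hr
  -- The registers after `k` rounds, `b + 3` being empty again.
  set G : ℕ → ℕ → ℕ := fun k => Function.update (Function.update (Function.update s b (N - k))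
    (b + 1) k) (b + 2) (r k) with hG
  have hGv (k : ℕ) (i : Fin n) : G k (ins i.succ) = s (ins i.succ) := by
    have := htail i
    simp only [hG]
    rw [Function.update_of_ne (by omega), Function.update_of_ne (by omega),
      Function.update_of_ne (by omega)]
  have hGz (k i : ℕ) (hi : b + 3 ≤ i) : G k i = 0 := by
    simp only [hG]
    rw [Function.update_of_ne (by omega), Function.update_of_ne (by omega),
      Function.update_of_ne (by omega), hs i (by omega)]
  rw [rel_mul_of_iff fun u => rel_copy ((hins 0).trans (by omega)).ne (by omega)
      (hs _ (by omega)),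
    rel_mul_of_iff (t := G 0) fun u => ?_, rel_mul_of_iff (t := G N) fun u => ?_,
    rel_mul_of_iff fun u => rel_clear, rel_move (by omega)]
  · have h1 : List.Vector.head (List.Vector.ofFn fun i => s (ins i)) = N := by simp [hN]
    have h2 : List.Vector.tail (List.Vector.ofFn fun i => s (ins i)) = v := by
      simp [hv, List.Vector.tail_ofFn]
    simp only [Part.mem_some_iff, exists_eq_left, h1, h2]
    refine Eq.congr_right ?_
    ext i
    have : s b = 0 := hs b le_rfl
    have : s (b + 1) = 0 := hs _ (by omega)
    have : s (b + 2) = 0 := hs _ (by omega)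
    simp only [hG, Function.update_apply]
    grind
  · refine rel_while G N (fun k => by simp [hG]) fun k t => ?_
    have hGb : G k b = N - k := by simp [hG]
    rw [rel_dec_mul, hGb, Nat.sub_pos_iff_lt]
    refine and_congr_right fun hk => ?_
    rw [rel_mul_of_iff fun u => hg _ u fun i hi => ?_, rel_mul_of_iff fun u => rel_clear,
      rel_mul_of_iff fun u => rel_move (by omega), rel_act, Step]
    · have hvec : (List.Vector.ofFn fun i : Fin (n + 2) => Function.update (G k) b (N - k - 1)
          ((Fin.cons (b + 1) (Fin.cons (b + 2) fun i => ins i.succ) : Fin (n + 2) → ℕ) i)) =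
          k ::ᵥ r k ::ᵥ v := by
        ext i
        refine Fin.cases ?_ (Fin.cases ?_ fun i => ?_) i
        · simp [hG]
        · rw [List.Vector.get_ofFn, List.Vector.get_cons_succ]
          simp [hG]
        · simp [hGv, hv, (htail i).ne]
      have hr' : g (k ::ᵥ r k ::ᵥ v) = r (k + 1) := rfl
      have : G k (b + 3) = 0 := hGz _ _ le_rfl
      rw [hvec, hr']
      refine Eq.congr_right ?_
      ext i
      have : s (b + 3) = 0 := hs _ (by omega)
      simp only [hG, Function.update_apply]
      grind
    · rw [Function.update_of_ne (by omega), hGz k i (by omega)]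
  · rw [hf _ u fun i hi => ?_]
    · refine Eq.congr_right ?_
      have hvec : (List.Vector.ofFn fun i => Function.update s b (s b + N) (ins i.succ)) = v := by
        ext i
        simp [hv, (htail i).ne]
      rw [hvec]
      ext i
      have : s b = 0 := hs b le_rfl
      have : s (b + 1) = 0 := hs _ (by omega)
      have : s (b + 2) = 0 := hs _ (by omega)
      have : r 0 = f v := rfl
      simp only [hG, Function.update_apply]
      grind
    · rw [Function.update_of_ne (by omega), hs i (by omega)]

theorem computes_primrec {n : ℕ} {f : List.Vector ℕ n → ℕ} (hf : Nat.Primrec' f) :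
    Computes fun v => Part.some (f v) := by
  induction hf with
  | zero => exact computes_zero
  | succ => exact computes_succ
  | get i => exact computes_get i
  | @comp m n f g _ _ hf hg =>
    have := hf.comp hg
    convert this using 2 with v
    simp [Vector.mOfFn_part_some]
  | prec _ _ hf hg => exact computes_prec hf hg

/-- Register `b` holds the candidate and `b + 1` the value of `f` there. The loop body starts by
decrementing that value and the exit by testing it for zero, so at each candidate only one of them
can proceed. An unsuccessful search has no complete run, which matches divergence. -/
theorem Computes.rfind {n : ℕ} {f : List.Vector ℕ (n + 1) → ℕ} (hf : Computes fun v => Part.some (f v)) :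
    Computes fun v => Nat.rfind fun k => (some (f (k ::ᵥ v) = 0 : Bool) : Part Bool) := by
  intro ins o b hins ho
  obtain ⟨F, hF, hf⟩ := hf.rel_iff (Fin.cons b ins) (b + 1) (b + 2)
    (Fin.cases (by simp) fun i => (hins i).trans (by simp)) (by omega)
  refine ⟨(F * (act (.dec (b + 1)) * (clear (b + 1) * act (.inc b))))∗ *
      (F * (act (.zero (b + 1)) * move b o)),
    (hF.mul ((isProg_act _).mul ((isProg_clear _).mul (isProg_act _)))).kstar.mul
      (hF.mul ((isProg_act _).mul (isProg_move _ _))), fun s t hs => ?_⟩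
  set v : List.Vector ℕ n := List.Vector.ofFn fun i => s (ins i) with hv
  set G : ℕ → ℕ → ℕ := fun k => Function.update s b k with hG
  have hG0 : G 0 = s := by simp [hG, ← hs b le_rfl]
  have hF' (k : ℕ) (u : ℕ → ℕ) :
      Rel F (G k) u ↔ u = Function.update (G k) (b + 1) (f (k ::ᵥ v)) := by
    have hvec : (List.Vector.ofFn fun i => G k ((Fin.cons b ins : Fin (n + 1) → ℕ) i)) =
        k ::ᵥ v := by
      ext i
      refine Fin.cases ?_ (fun i => ?_) i
      · simp [hG]
      · simp [hG, hv, (hins i).ne]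
    have hb : G k (b + 1) = 0 := by simp [hG, hs (b + 1) (by omega)]
    rw [hf, hvec, hb, zero_add]
    intro i hi
    simp only [hG]
    rw [Function.update_of_ne (by omega), hs i (by omega)]
  have hstar (t : ℕ → ℕ) := rel_kstar_of_trajectory G (fun k => 0 < f (k ::ᵥ v)) (t := t)
    (L := F * (act (.dec (b + 1)) * (clear (b + 1) * act (.inc b)))) fun k t => by
      rw [rel_mul_of_iff (hF' k), rel_dec_mul, rel_mul_of_iff fun u => rel_clear, rel_act, Step]
      refine and_congr (by simp) (Eq.congr_right ?_)
      ext i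
      have : s (b + 1) = 0 := hs _ (by omega)
      simp only [hG, Function.update_apply]
      grind
  rw [hG0] at hstar
  have hlast (N : ℕ) : Rel (F * (act (.zero (b + 1)) * move b o)) (G N) t ↔
      f (N ::ᵥ v) = 0 ∧ t = Function.update s o (s o + N) := by
    rw [rel_mul_of_iff (hF' N), rel_zero_mul, rel_move ho.ne']
    simp only [Function.update_self]
    refine and_congr_right fun h0 => Eq.congr_right ?_
    ext i
    have : s b = 0 := hs b le_rfl
    have : s (b + 1) = 0 := hs _ (by omega)
    simp only [hG, Function.update_apply]
    grind
  have hfind (y : ℕ) : y ∈ Nat.rfind (fun k => (some (f (k ::ᵥ v) = 0 : Bool) : Part Bool)) ↔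
      f (y ::ᵥ v) = 0 ∧ ∀ m < y, 0 < f (m ::ᵥ v) :=
    Nat.mem_rfind.trans (by simp [Nat.pos_iff_ne_zero])
  rw [rel_mul]
  constructor
  · rintro ⟨u, hu, h⟩
    obtain ⟨N, hN, rfl⟩ := (hstar u).1 hu
    obtain ⟨h0, rfl⟩ := (hlast N).1 h
    exact ⟨N, (hfind N).2 ⟨h0, hN⟩, rfl⟩
  · rintro ⟨N, hN, rfl⟩
    obtain ⟨h0, hN⟩ := (hfind N).1 hN
    exact ⟨_, (hstar _).2 ⟨N, hN, rfl⟩, (hlast N).2 ⟨h0, rfl⟩⟩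

theorem computes_partrec {n : ℕ} {f : List.Vector ℕ n →. ℕ} (hf : Nat.Partrec' f) :
    Computes f := by
  induction hf with
  | prim h => exact computes_primrec h
  | comp g _ _ hf hg => exact hf.comp hg
  | rfind _ hf => exact hf.rfind

end CounterAct

/-! ### Acceptance from a configuration. -/

namespace SAFA

variable {Q A H D : Type*} [DecidableEq H]

/-- Some run from the configuration `(q, h)` over `w` ends in a final state. -/
def Accepts (M : SAFA Q A H) (q : Q) (h : H → Set D) (w : List (A × D)) : Prop :=
  ∃ q' ∈ M.final, ∃ h' : H → Set D, M.Run q h w q' h'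

theorem accepts_nil {M : SAFA Q A H} {q : Q} {h : H → Set D} :
    M.Accepts q h [] ↔ q ∈ M.final := by
  constructor
  · rintro ⟨_, hq, _, ⟨⟩⟩
    exact hq
  · exact fun hq => ⟨q, hq, h, .nil q h⟩

theorem accepts_cons {M : SAFA Q A H} {q : Q} {h : H → Set D} {a : A} {d : D}
    {w : List (A × D)} :
    M.Accepts q h ((a, d) :: w) ↔
      ∃ c op r, (q, a, c, op, r) ∈ M.trans ∧ c.Holds h d ∧ M.Accepts r (op.apply h d) w := by
  constructor
  · rintro ⟨q', hq, h', hr⟩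
    cases hr with
    | cons ht hc hrun => exact ⟨_, _, _, ht, hc, q', hq, h', hrun⟩
  · rintro ⟨c, op, r, ht, hc, q', hq, h', hrun⟩
    exact ⟨q', hq, h', .cons ht hc hrun⟩

theorem isUniversal_iff {M : SAFA Q A H} :
    M.IsUniversal D ↔ ∀ w : List (A × D), M.Accepts M.start (fun _ => ∅) w :=
  Set.eq_univ_iff_forall

end SAFA

/-! ### The monitor of faulty runs. -/

/-- The sets of the automaton recognising faulty counter machine runs: the values of the increments
and decrements of each register so far, and a value of a single increment being watched. -/
inductive MonitorSet (R : Type*) where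
  | watched
  | incd (r : R)
  | decd (r : R)
  deriving DecidableEq, Fintype

namespace MonitorSet

variable {R D : Type*} [DecidableEq R]

/-- The contents of the sets, put together. -/
def contents (I X : R → Set D) (W : Set D) : MonitorSet R → Set D
  | .watched => W
  | .incd r => I r
  | .decd r => X r

theorem update_contents_watched (I X : R → Set D) (W V : Set D) :
    Function.update (contents I X W) .watched V = contents I X V := by
  ext1 i
  cases i <;> simp [contents]

theorem update_contents_incd (I X : R → Set D) (W V : Set D) (r : R) :
    Function.update (contents I X W) (.incd r) V = contents (Function.update I r V) X W := by
  ext1 i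
  cases i <;> simp [contents, Function.update_apply]

theorem update_contents_decd (I X : R → Set D) (W V : Set D) (r : R) :
    Function.update (contents I X W) (.decd r) V = contents I (Function.update X r V) W := by
  ext1 i
  cases i <;> simp [contents, Function.update_apply]

end MonitorSet

namespace CounterAct

open MonitorSet SAFA

variable {R C D : Type*}

/-- The transitions of the automaton recognising faulty counter machine runs. Its states are those
of the control (`.inl q`), an accepting sink (`.inr none`) and states watching an increment of a
register (`.inr (some r)`). -/
inductive MonitorTrans (step : C → CounterAct R → Option C) :
    C ⊕ Option R → CounterAct R → Cond (MonitorSet R) → Op (MonitorSet R) → C ⊕ Option R → Prop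
  | inc {q q' r} : step q (.inc r) = some q' →
      MonitorTrans step (.inl q) (.inc r) (.notMem (.incd r)) (.ins (.incd r)) (.inl q')
  | incAgain {q r} :
      MonitorTrans step (.inl q) (.inc r) (.mem (.incd r)) .skip (.inr none)
  -- The guess that this value is not decremented before the next zero test of `r`; from here on
  -- nothing else is checked.
  | watch {q r} :
      MonitorTrans step (.inl q) (.inc r) (.notMem (.incd r)) (.ins .watched) (.inr (some r))
  | dec {q q' r} : step q (.dec r) = some q' →
      MonitorTrans step (.inl q) (.dec r) (.notMem (.decd r)) (.ins (.decd r)) (.inl q')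
  | decAgain {q r} :
      MonitorTrans step (.inl q) (.dec r) (.mem (.decd r)) .skip (.inr none)
  | decFresh {q r} :
      MonitorTrans step (.inl q) (.dec r) (.notMem (.incd r)) .skip (.inr none)
  -- Every SAFA transition carries a condition; leaving `c` free makes the move unconditional.
  | zero {q q' r c} : step q (.zero r) = some q' →
      MonitorTrans step (.inl q) (.zero r) c .skip (.inl q')
  | stuck {q a c} : step q a = none → MonitorTrans step (.inl q) a c .skip (.inr none)
  | watchDec {r} :
      MonitorTrans step (.inr (some r)) (.dec r) (.notMem .watched) .skip (.inr (some r))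
  | watchZero {r c} : MonitorTrans step (.inr (some r)) (.zero r) c .skip (.inr none)
  | watchOther {r a c} : a ≠ .dec r → a ≠ .zero r →
      MonitorTrans step (.inr (some r)) a c .skip (.inr (some r))
  | sink {a c} : MonitorTrans step (.inr none) a c .skip (.inr none)

/-- The automaton that accepts the data words which are not the record of a run of a counter
machine with the given control. -/
def monitor (step : C → CounterAct R → Option C) (q₀ : C) (acc : Set C) :
    SAFA (C ⊕ Option R) (CounterAct R) (MonitorSet R) where
  start := .inl q₀
  final := {x | x = .inr none ∨ ∃ q ∉ acc, x = .inl q}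
  trans := {t | MonitorTrans step t.1 t.2.1 t.2.2.1 t.2.2.2.1 t.2.2.2.2}

/-- The control accepts a sequence of actions. -/
def ControlAccepts (step : C → CounterAct R → Option C) (acc : Set C) :
    C → List (CounterAct R) → Prop
  | q, [] => q ∈ acc
  | q, a :: w => ∃ q', step q a = some q' ∧ ControlAccepts step acc q' w

/-- A decrement of `r` with value `d` precedes all zero tests of `r`. -/
def Watched (r : R) (d : D) : List (CounterAct R × D) → Prop
  | [] => True
  | (a, e) :: w => (a = .dec r ∧ e = d) ∨ (a ≠ .zero r ∧ Watched r d w)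

/-- A data word records the run of a counter machine: every increment has a new value, every
decrement the value of an earlier increment not decremented yet, and before a zero test all
increments have been decremented. `I` and `X` hold the values used before. -/
def Faultless [DecidableEq R] : (R → Set D) → (R → Set D) → List (CounterAct R × D) → Prop
  | _, _, [] => True
  | I, X, (.inc r, d) :: w =>
    d ∉ I r ∧ Watched r d w ∧ Faultless (Function.update I r (insert d (I r))) X w
  | I, X, (.dec r, d) :: w =>
    d ∈ I r ∧ d ∉ X r ∧ Faultless I (Function.update X r (insert d (X r))) w
  | I, X, (.zero _, _) :: w => Faultless I X w

theorem exists_holds (h : MonitorSet R → Set D) (d : D) :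
    ∃ c : Cond (MonitorSet R), c.Holds h d := by
  by_cases hd : d ∈ h .watched
  exacts [⟨.mem .watched, hd⟩, ⟨.notMem .watched, hd⟩]

section Monitor

variable [DecidableEq R] {step : C → CounterAct R → Option C} {q₀ : C} {acc : Set C}

theorem monitor_accepts_sink (h : MonitorSet R → Set D) (w : List (CounterAct R × D)) :
    (monitor step q₀ acc).Accepts (.inr none) h w := by
  induction w generalizing h with
  | nil => exact accepts_nil.2 (.inl rfl)
  | cons x w ih =>
    obtain ⟨c, hc⟩ := exists_holds h x.2
    exact accepts_cons.2 ⟨c, .skip, .inr none, .sink, hc, ih _⟩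

/-- A watching run blocks when `d` is decremented, reaches the sink at a zero test of `r`, and
rejects if the word ends first. -/
theorem monitor_accepts_watch {I X : R → Set D} {r : R} {d : D} {w : List (CounterAct R × D)} :
    (monitor step q₀ acc).Accepts (.inr (some r)) (contents I X {d}) w ↔ ¬ Watched r d w := by
  induction w with
  | nil => simp [accepts_nil, monitor, Watched]
  | cons x w ih =>
    obtain ⟨a, e⟩ := x
    obtain ⟨c₀, hc₀⟩ := exists_holds (contents I X {d}) e
    simp only [Watched, not_or, not_and]
    rw [accepts_cons]
    constructor
    · rintro ⟨c, op, x, ht, hc, hacc⟩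
      cases ht with
      | watchDec =>
        refine ⟨fun _ he => hc (by simpa [contents] using he), fun _ => ih.1 hacc⟩
      | watchZero => exact ⟨by simp, by simp⟩
      | watchOther h1 h2 => exact ⟨fun h => (h1 h).elim, fun _ => ih.1 hacc⟩
    · rintro ⟨h1, h2⟩
      by_cases hz : a = .zero r
      · subst hz
        exact ⟨c₀, .skip, .inr none, .watchZero, hc₀, monitor_accepts_sink _ _⟩
      by_cases hd : a = .dec r
      · subst hd
        exact ⟨_, .skip, _, .watchDec, fun h => h1 rfl h, ih.2 (h2 hz)⟩
      · exact ⟨c₀, .skip, _, .watchOther hd hz, hc₀, ih.2 (h2 hz)⟩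

/-- Every fault in the first letter has a transition of its own, and otherwise the main branch
updates `I` and `X` as `Faultless` does. The watched set is still empty here, because inserting into
it leaves the main states for good. -/
theorem monitor_accepts_main {I X : R → Set D} {q : C} {w : List (CounterAct R × D)} :
    (monitor step q₀ acc).Accepts (.inl q) (contents I X ∅) w ↔
      ¬ (Faultless I X w ∧ ControlAccepts step acc q (w.map Prod.fst)) := by
  induction w generalizing I X q with
  | nil => simp [accepts_nil, monitor, Faultless, ControlAccepts]
  | cons x w ih =>
    obtain ⟨a, d⟩ := x
    have hI (r : R) : (Op.ins (.incd r)).apply (contents I X ∅) d =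
      contents (Function.update I r (insert d (I r))) X ∅ := update_contents_incd _ _ _ _ _
    have hX (r : R) : (Op.ins (.decd r)).apply (contents I X ∅) d =
      contents I (Function.update X r (insert d (X r))) ∅ := update_contents_decd _ _ _ _ _
    have hW : (Op.ins .watched).apply (contents I X ∅) d = contents I X {d} := by
      simp [Op.apply, update_contents_watched, contents]
    obtain ⟨c₀, hc₀⟩ := exists_holds (contents I X ∅) d
    rw [accepts_cons, List.map_cons]
    constructor
    · rintro ⟨c, op, x, ht, hc, hacc⟩ ⟨hF, q'', hq'', hC⟩
      cases ht with
      | inc h =>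
        rw [hI, ih] at hacc
        obtain rfl := Option.some.inj (h.symm.trans hq'')
        exact hacc ⟨hF.2.2, hC⟩
      | incAgain => exact hF.1 hc
      | watch =>
        rw [hW, monitor_accepts_watch] at hacc
        exact hacc hF.2.1
      | dec h =>
        rw [hX, ih] at hacc
        obtain rfl := Option.some.inj (h.symm.trans hq'')
        exact hacc ⟨hF.2.2, hC⟩
      | decAgain => exact hF.2.1 hc
      | decFresh => exact hc hF.1
      | zero h =>
        obtain rfl := Option.some.inj (h.symm.trans hq'')
        exact ih.1 hacc ⟨hF, hC⟩
      | stuck h => simp [h] at hq''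
    · intro hn
      rcases hstep : step q a with _ | q'
      · exact ⟨c₀, .skip, _, .stuck hstep, hc₀, monitor_accepts_sink _ _⟩
      cases a with
      | inc r =>
        by_cases h1 : d ∈ I r
        · exact ⟨_, _, _, .incAgain, h1, monitor_accepts_sink _ _⟩
        by_cases h2 : Watched r d w
        · refine ⟨_, _, _, .inc hstep, h1, ?_⟩
          rw [hI, ih]
          exact fun h => hn ⟨⟨h1, h2, h.1⟩, q', hstep, h.2⟩
        · refine ⟨_, _, _, .watch, h1, ?_⟩
          rwa [hW, monitor_accepts_watch]
      | dec r =>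
        by_cases h1 : d ∈ I r
        · by_cases h2 : d ∈ X r
          · exact ⟨_, _, _, .decAgain, h2, monitor_accepts_sink _ _⟩
          · refine ⟨_, _, _, .dec hstep, h2, ?_⟩
            rw [hX, ih]
            exact fun h => hn ⟨⟨h1, h2, h.1⟩, q', hstep, h.2⟩
        · exact ⟨_, _, _, .decFresh, h1, monitor_accepts_sink _ _⟩
      | zero r =>
        exact ⟨c₀, .skip, _, .zero hstep, hc₀, ih.2 fun h => hn ⟨h.1, q', hstep, h.2⟩⟩

/-- The invariant is that register `r` contains the number of elements of `I r \ X r`, the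
uncancelled values, and that each of these is still watched. A zero test contradicts watching, so
the difference is empty there. -/
theorem exec_of_faultless {I X : R → Set D} {s : R → ℕ} {w : List (CounterAct R × D)}
    (hw : Faultless I X w) (hXI : ∀ r, X r ⊆ I r) (hs : ∀ r, (I r \ X r).encard = s r)
    (hwatch : ∀ r, ∀ d ∈ I r \ X r, Watched r d w) : ∃ s', Exec (w.map Prod.fst) s s' := by
  induction w generalizing I X s with
  | nil => exact ⟨s, rfl⟩
  | cons x w ih =>
    obtain ⟨a, d⟩ := x
    cases a with
    | inc r =>
      obtain ⟨hd, hW, hF⟩ := hw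
      obtain ⟨s', h⟩ : ∃ s', Exec (w.map Prod.fst) (Function.update s r (s r + 1)) s' := by
        refine ih hF (fun r' => ?_) (fun r' => ?_) fun r' e he => ?_
        · rcases eq_or_ne r' r with rfl | hr
          · simpa using (hXI r').trans (Set.subset_insert _ _)
          · simpa [hr] using hXI r'
        · rcases eq_or_ne r' r with rfl | hr
          · rw [Function.update_self, Function.update_self,
              Set.insert_sdiff_of_notMem _ fun h => hd (hXI _ h),
              Set.encard_insert_of_notMem fun h => hd h.1, hs]
            simp
          · simpa [hr] using hs r'
        · have hW' : e ∈ I r' \ X r' → Watched r' e w := fun he => by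
            simpa [Watched] using hwatch r' e he
          rcases eq_or_ne r' r with rfl | hr
          · rw [Function.update_self] at he
            rcases he.1 with rfl | he'
            · exact hW
            · exact hW' ⟨he', he.2⟩
          · rw [Function.update_of_ne hr] at he
            exact hW' he
      exact ⟨s', _, rfl, h⟩
    | dec r =>
      obtain ⟨hdI, hdX, hF⟩ := hw
      have hpos : 0 < s r := by
        rw [Nat.pos_iff_ne_zero]
        intro h0
        have := hs r
        rw [h0, Nat.cast_zero, Set.encard_eq_zero] at this
        exact (this ▸ (⟨hdI, hdX⟩ : d ∈ I r \ X r) : d ∈ (∅ : Set D))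
      have hdiff : I r \ insert d (X r) = (I r \ X r) \ {d} := by
        rw [Set.sdiff_sdiff, Set.union_comm, Set.singleton_union]
      obtain ⟨s', h⟩ : ∃ s', Exec (w.map Prod.fst) (Function.update s r (s r - 1)) s' := by
        refine ih hF (fun r' => ?_) (fun r' => ?_) fun r' e he => ?_
        · rcases eq_or_ne r' r with rfl | hr
          · simpa using Set.insert_subset hdI (hXI r')
          · simpa [hr] using hXI r'
        · rcases eq_or_ne r' r with rfl | hr
          · rw [Function.update_self, Function.update_self, hdiff,
              Set.encard_sdiff_singleton_of_mem (Set.mem_sdiff _ |>.2 ⟨hdI, hdX⟩), hs]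
            simp
          · simpa [hr] using hs r'
        · rcases eq_or_ne r' r with rfl | hr
          · rw [Function.update_self, hdiff] at he
            have := hwatch r' e he.1
            have hne : d ≠ e := fun h => he.2 h.symm
            simpa [Watched, hne] using this
          · rw [Function.update_of_ne hr] at he
            have := hwatch r' e he
            simpa [Watched, hr.symm] using this
      exact ⟨s', _, ⟨hpos, rfl⟩, h⟩
    | zero r =>
      have hempty : I r \ X r = ∅ := by
        rw [Set.eq_empty_iff_forall_notMem]
        intro e he
        simpa [Watched] using hwatch r e he
      have h0 : s r = 0 := by
        have := hs r
        rw [hempty, Set.encard_empty] at this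
        exact_mod_cast this.symm
      obtain ⟨s', h⟩ := ih (s := s) hw hXI hs fun r' e he => by
        have := hwatch r' e he
        simp only [Watched] at this
        rcases this with ⟨h, _⟩ | h
        exacts [by simp at h, h.2]
      exact ⟨s', s, ⟨h0, rfl⟩, h⟩

/-- Increments receive a value outside the finite set `I r`, decrements any uncancelled value. The
watching clause strengthens the induction: it supplies the condition that `Faultless` imposes on a
new increment. -/
theorem exists_faultless_of_exec [Infinite D] {I X : R → Set D} {s s' : R → ℕ}
    {u : List (CounterAct R)} (hu : Exec u s s') (hI : ∀ r, (I r).Finite) (hXI : ∀ r, X r ⊆ I r)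
    (hs : ∀ r, (I r \ X r).encard = s r) :
    ∃ w : List (CounterAct R × D), w.map Prod.fst = u ∧ Faultless I X w ∧
      ∀ r, ∀ d ∈ I r \ X r, Watched r d w := by
  induction u generalizing I X s with
  | nil => exact ⟨[], rfl, trivial, fun _ _ _ => trivial⟩
  | cons a u ih =>
    obtain ⟨t, hstep, hu⟩ := hu
    cases a with
    | inc r =>
      obtain rfl : t = Function.update s r (s r + 1) := hstep
      obtain ⟨d, hd⟩ := (hI r).exists_notMem
      obtain ⟨w, rfl, hF, hW⟩ : ∃ w : List (CounterAct R × D), w.map Prod.fst = u ∧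
          Faultless (Function.update I r (insert d (I r))) (X) w ∧
          ∀ r', ∀ e ∈ (Function.update I r (insert d (I r))) r' \ (X) r', Watched r' e w := by
        refine ih hu (fun r' => ?_) (fun r' => ?_) fun r' => ?_
        · rcases eq_or_ne r' r with rfl | hr
          · simpa using (hI r').insert d
          · simpa [hr] using hI r'
        · rcases eq_or_ne r' r with rfl | hr
          · simpa using (hXI r').trans (Set.subset_insert _ _)
          · simpa [hr] using hXI r'
        · rcases eq_or_ne r' r with rfl | hr
          · rw [Function.update_self, Function.update_self,
              Set.insert_sdiff_of_notMem _ fun h => hd (hXI _ h),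
              Set.encard_insert_of_notMem fun h => hd h.1, hs]
            simp
          · simpa [hr] using hs r'
      refine ⟨(.inc r, d) :: w, rfl, ⟨hd, hW r d ?_, hF⟩, fun r' e he => .inr ⟨by simp, ?_⟩⟩
      · simpa using fun h => hd (hXI r h)
      · refine hW r' e ?_
        rcases eq_or_ne r' r with rfl | hr
        · simpa [he.2] using .inr he.1
        · simpa [hr] using he
    | dec r =>
      obtain ⟨hpos, rfl⟩ : _ ∧ t = Function.update s r (s r - 1) := hstep
      obtain ⟨d, hdI, hdX⟩ : (I r \ X r).Nonempty := by
        rw [← Set.encard_pos, hs]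
        exact_mod_cast hpos
      have hdiff : I r \ insert d (X r) = (I r \ X r) \ {d} := by
        rw [Set.sdiff_sdiff, Set.union_comm, Set.singleton_union]
      obtain ⟨w, rfl, hF, hW⟩ : ∃ w : List (CounterAct R × D), w.map Prod.fst = u ∧
          Faultless (I) (Function.update X r (insert d (X r))) w ∧
          ∀ r', ∀ e ∈ (I) r' \ (Function.update X r (insert d (X r))) r', Watched r' e w := by
        refine ih hu hI (fun r' => ?_) fun r' => ?_
        · rcases eq_or_ne r' r with rfl | hr
          · simpa using Set.insert_subset hdI (hXI r')
          · simpa [hr] using hXI r'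
        · rcases eq_or_ne r' r with rfl | hr
          · rw [Function.update_self, Function.update_self, hdiff,
              Set.encard_sdiff_singleton_of_mem (Set.mem_sdiff _ |>.2 ⟨hdI, hdX⟩), hs]
            simp
          · simpa [hr] using hs r'
      refine ⟨(.dec r, d) :: w, rfl, ⟨hdI, hdX, hF⟩, fun r' e he => ?_⟩
      by_cases h : r = r' ∧ d = e
      · obtain ⟨rfl, rfl⟩ := h
        exact .inl ⟨rfl, rfl⟩
      · refine .inr ⟨by simp, hW r' e ?_⟩
        rcases eq_or_ne r' r with rfl | hr
        · rw [Function.update_self, hdiff]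
          exact ⟨he, fun hh => h ⟨rfl, hh.symm⟩⟩
        · simpa [hr] using he
    | zero r =>
      obtain ⟨h0, rfl⟩ : s r = 0 ∧ t = s := hstep
      obtain ⟨w, rfl, hF, hW⟩ := ih hu hI hXI hs
      -- The value attached to a zero test is irrelevant.
      obtain ⟨d⟩ : Nonempty D := inferInstance
      refine ⟨(.zero r, d) :: w, rfl, hF, fun r' e he => .inr ⟨?_, hW r' e he⟩⟩
      rintro h
      obtain rfl := CounterAct.zero.inj h
      have := hs r
      rw [h0, Nat.cast_zero, Set.encard_eq_zero] at this
      exact (this ▸ he : e ∈ (∅ : Set D))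

/-- The monitor is universal if and only if the counter machine has no accepting run. -/
theorem monitor_isUniversal_iff [Infinite D] : (monitor step q₀ acc).IsUniversal D ↔
    ¬ ∃ u s', ControlAccepts step acc q₀ u ∧ Exec u (fun _ : R => 0) s' := by
  have hempty : (fun _ => ∅ : MonitorSet R → Set D) = contents (fun _ => ∅) (fun _ => ∅) ∅ := by
    ext1 i
    cases i <;> rfl
  rw [isUniversal_iff, hempty]
  change (∀ w, (monitor step q₀ acc).Accepts (.inl q₀) _ w) ↔ _
  simp only [monitor_accepts_main]
  rw [← not_exists, not_iff_not]
  constructor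
  · rintro ⟨w, hF, hC⟩
    obtain ⟨s', h⟩ := exec_of_faultless hF (s := fun _ => 0) (by simp) (by simp) (by simp)
    exact ⟨_, s', hC, h⟩
  · rintro ⟨u, s', hC, h⟩
    obtain ⟨w, rfl, hF, -⟩ := exists_faultless_of_exec (D := D) (I := fun _ => ∅)
      (X := fun _ => ∅) h (by simp) (by simp) (by simp)
    exact ⟨w, hF, hC⟩

end Monitor

end CounterAct

/-! ### A fixed finite control, and chains that load its input. -/

namespace CounterAct

section Control

variable {R R' : Type*} [DecidableEq R] [DecidableEq R']

/-- Rename the register of an action. -/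
def map (e : R → R') : CounterAct R → CounterAct R'
  | .inc r => .inc (e r)
  | .dec r => .dec (e r)
  | .zero r => .zero (e r)

theorem exists_exec_cons {a : CounterAct R} {w : List (CounterAct R)} {s : R → ℕ} :
    (∃ t, Exec (a :: w) s t) ↔ ∃ u, a.Step s u ∧ ∃ t, Exec w u t :=
  ⟨fun ⟨t, u, h, h'⟩ => ⟨u, h, t, h'⟩, fun ⟨u, h, t, h'⟩ => ⟨t, u, h, h'⟩⟩

/-- Registers outside the range of `e` are never touched, so they do not affect whether the sequence
can be executed. -/
theorem exists_exec_map_iff {e : R → R'} (he : Function.Injective e) {w : List (CounterAct R)}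
    {s : R' → ℕ} : (∃ t, Exec (w.map (map e)) s t) ↔ ∃ t, Exec w (s ∘ e) t := by
  induction w generalizing s with
  | nil => exact ⟨fun _ => ⟨_, rfl⟩, fun _ => ⟨_, rfl⟩⟩
  | cons a w ih =>
    have hupd (r : R) (x : ℕ) : Function.update s (e r) x ∘ e = Function.update (s ∘ e) r x :=
      Function.update_comp_eq_of_injective s he r x
    rw [List.map_cons, exists_exec_cons, exists_exec_cons]
    simp only [ih]
    cases a <;> simp [Step, map, hupd]

theorem exec_replicate_inc {r : R} {n : ℕ} {w : List (CounterAct R)} {s t : R → ℕ} :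
    Exec (List.replicate n (.inc r) ++ w) s t ↔ Exec w (Function.update s r (s r + n)) t := by
  induction n generalizing s with
  | zero => simp
  | succ n ih =>
    rw [List.replicate_succ, List.cons_append, Exec]
    simp [Step, ih, add_assoc, add_comm 1]

/-- A partial recursive function is defined at `n` if and only if a counter machine with a fixed
finite control has an accepting run that starts with the content `n` of a register. -/
theorem exists_dfa_of_partrec {f : ℕ →. ℕ} (hf : Partrec f) :
    ∃ (K : ℕ) (σ : Type) (_ : Fintype σ) (M : DFA (CounterAct (Fin (K + 1))) σ), ∀ n,
      (f n).Dom ↔ ∃ w t, w ∈ M.accepts ∧ Exec w (Function.update (fun _ => 0) 0 n) t := by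
  obtain ⟨L, ⟨hreg, K, hK⟩, h⟩ := computes_partrec (Nat.Partrec'.part_iff₁.2 hf) (fun _ => 0) 1 2
    (by simp) (by simp)
  obtain ⟨σ, hσ, M, rfl⟩ := hreg
  -- All accepted words use registers below `K`, so restricting the alphabet loses none; `K + 1`
  -- ensures that the input register `0` exists.
  refine ⟨K, σ, hσ, M.comap (map Fin.val), fun n => ?_⟩
  have hn := fun t => h (Function.update (fun _ => 0) 0 n) t fun i hi => by
    rw [Function.update_of_ne (by omega)]
  have hcomp : (Function.update (fun _ => 0) 0 n : ℕ → ℕ) ∘ (Fin.val : Fin (K + 1) → ℕ) =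
      Function.update (fun _ => 0) 0 n :=
    Function.update_comp_eq_of_injective (fun _ => 0) Fin.val_injective 0 n
  have h1 : (f n).Dom ↔ ∃ t, Rel M.accepts (Function.update (fun _ => 0) 0 n) t := by
    simp only [hn, Part.dom_iff_mem]
    constructor
    · rintro ⟨y, hy⟩
      exact ⟨_, y, by simpa using hy, rfl⟩
    · rintro ⟨_, y, hy, -⟩
      exact ⟨y, by simpa using hy⟩
  rw [h1]
  simp only [DFA.accepts_comap]
  constructor
  · rintro ⟨t, w, hw, ht⟩
    have : w ∈ Set.range (List.map (map (Fin.val : Fin (K + 1) → ℕ))) := by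
      rw [Set.range_list_map]
      intro a ha
      have := hK w hw a ha
      cases a with
      | inc r => exact ⟨.inc ⟨r, Nat.lt_succ_of_lt this⟩, rfl⟩
      | dec r => exact ⟨.dec ⟨r, Nat.lt_succ_of_lt this⟩, rfl⟩
      | zero r => exact ⟨.zero ⟨r, Nat.lt_succ_of_lt this⟩, rfl⟩
    obtain ⟨v, rfl⟩ := this
    obtain ⟨t', ht'⟩ := (exists_exec_map_iff Fin.val_injective).1 ⟨t, ht⟩
    exact ⟨v, t', hw, hcomp ▸ ht'⟩
  · rintro ⟨v, t', hv, ht'⟩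
    obtain ⟨t, ht⟩ := (exists_exec_map_iff (s := Function.update (fun _ => 0) 0 n)
      Fin.val_injective (w := v)).2 ⟨t', hcomp.symm ▸ ht'⟩
    exact ⟨t, _, hv, ht⟩

/-- The position `i` of a chain that ends in the state `q₀`. -/
def chainPos {σ : Type*} (q₀ : σ) {n : ℕ} : Fin (n + 1) → σ ⊕ Fin n :=
  Fin.cases (motive := fun _ => σ ⊕ Fin n) (.inl q₀) .inr

/-- The control of a counter machine that follows a chain of increments of the register `r₀` before
it turns into `M`. -/
def chainStep {σ : Type*} (M : DFA (CounterAct R) σ) (r₀ : R) (n : ℕ) :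
    σ ⊕ Fin n → CounterAct R → Option (σ ⊕ Fin n)
  | .inl q, a => some (.inl (M.step q a))
  -- `.inr i` is position `i + 1` and `i.castSucc` is position `i`: the chain counts down to the
  -- start of `M`.
  | .inr i, a => if a = .inc r₀ then some (chainPos M.start i.castSucc) else none

theorem controlAccepts_chainStep_inl {σ : Type*} {M : DFA (CounterAct R) σ} {r₀ : R} {n : ℕ}
    {q : σ} {u : List (CounterAct R)} :
    ControlAccepts (chainStep M r₀ n) (Sum.inl '' M.accept) (.inl q) u ↔
      u ∈ M.acceptsFrom q := by
  induction u generalizing q with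
  | nil => simp [ControlAccepts, DFA.mem_acceptsFrom]
  | cons a u ih => simp [ControlAccepts, chainStep, ih, DFA.mem_acceptsFrom]

theorem controlAccepts_chainStep {σ : Type*} {M : DFA (CounterAct R) σ} {r₀ : R} {n : ℕ}
    (i : Fin (n + 1)) {u : List (CounterAct R)} :
    ControlAccepts (chainStep M r₀ n) (Sum.inl '' M.accept) (chainPos M.start i) u ↔
      ∃ v ∈ M.accepts, u = List.replicate i (.inc r₀) ++ v := by
  induction i using Fin.induction generalizing u with
  | zero => simp [chainPos, controlAccepts_chainStep_inl, DFA.accepts]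
  | succ i ih =>
    change ControlAccepts _ _ (Sum.inr i) u ↔ _
    cases u with
    | nil => simp [ControlAccepts, List.replicate_succ]
    | cons a u =>
      simp only [ControlAccepts, chainStep, Option.ite_none_right_eq_some, Option.some.injEq,
        Fin.val_succ, List.replicate_succ, List.cons_append, List.cons.injEq]
      constructor
      · rintro ⟨_, ⟨rfl, rfl⟩, h⟩
        obtain ⟨v, hv, rfl⟩ := ih.1 h
        exact ⟨v, hv, rfl, rfl⟩
      · rintro ⟨v, hv, rfl, rfl⟩
        exact ⟨_, ⟨rfl, rfl⟩, ih.2 ⟨v, hv, rfl⟩⟩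

theorem monitor_chainStep_isUniversal_iff {D : Type*} [Infinite D] {σ : Type*}
    (M : DFA (CounterAct R) σ) (r₀ : R) (n : ℕ) :
    (monitor (chainStep M r₀ n) (chainPos M.start (Fin.last n)) (Sum.inl '' M.accept)).IsUniversal D
      ↔ ¬ ∃ w t, w ∈ M.accepts ∧ Exec w (Function.update (fun _ => 0) r₀ n) t := by
  rw [monitor_isUniversal_iff, not_iff_not]
  simp only [controlAccepts_chainStep, Fin.val_last]
  constructor
  · rintro ⟨_, t, ⟨v, hv, rfl⟩, h⟩
    exact ⟨v, t, hv, by simpa using exec_replicate_inc.1 h⟩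
  · rintro ⟨v, t, hv, h⟩
    exact ⟨_, t, ⟨v, hv, rfl⟩, exec_replicate_inc.2 (by simpa using h)⟩

end Control

/-! ### Transfer of monitor transitions between controls. -/

section Map

variable {R C C' : Type*}

/-- The transitions leaving a control state depend only on `step` at that state, so agreement at `q`
alone suffices and `f` may be any map. This allows each chain state to be compared with one small
template. -/
theorem monitorTrans_inl_map {step : C → CounterAct R → Option C}
    {step' : C' → CounterAct R → Option C'} (f : C → C') {q : C}
    (h : ∀ a, step' (f q) a = (step q a).map f) (a : CounterAct R)
    (c : SAFA.Cond (MonitorSet R)) (op : SAFA.Op (MonitorSet R)) (x' : C' ⊕ Option R) :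
    MonitorTrans step' (.inl (f q)) a c op x' ↔
      ∃ x, MonitorTrans step (.inl q) a c op x ∧ x' = Sum.map f id x := by
  constructor
  · intro ht
    cases ht with
    | inc hs =>
      obtain ⟨q', hq, rfl⟩ := Option.map_eq_some_iff.1 ((h _).symm.trans hs)
      exact ⟨_, .inc hq, rfl⟩
    | dec hs =>
      obtain ⟨q', hq, rfl⟩ := Option.map_eq_some_iff.1 ((h _).symm.trans hs)
      exact ⟨_, .dec hq, rfl⟩
    | zero hs =>
      obtain ⟨q', hq, rfl⟩ := Option.map_eq_some_iff.1 ((h _).symm.trans hs)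
      exact ⟨_, .zero hq, rfl⟩
    | incAgain => exact ⟨_, .incAgain, rfl⟩
    | watch => exact ⟨_, .watch, rfl⟩
    | decAgain => exact ⟨_, .decAgain, rfl⟩
    | decFresh => exact ⟨_, .decFresh, rfl⟩
    | stuck hs => exact ⟨_, .stuck (Option.map_eq_none_iff.1 ((h _).symm.trans hs)), rfl⟩
  · rintro ⟨x, ht, rfl⟩
    cases ht with
    | inc hs => exact .inc (by rw [h, hs]; rfl)
    | dec hs => exact .dec (by rw [h, hs]; rfl)
    | zero hs => exact .zero (by rw [h, hs]; rfl)
    | incAgain => exact .incAgain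
    | watch => exact .watch
    | decAgain => exact .decAgain
    | decFresh => exact .decFresh
    | stuck hs => exact .stuck (by rw [h, hs]; rfl)

theorem monitorTrans_inr_map (step : C → CounterAct R → Option C)
    {step' : C' → CounterAct R → Option C'} (f : C → C') (o : Option R) (a : CounterAct R)
    (c : SAFA.Cond (MonitorSet R)) (op : SAFA.Op (MonitorSet R)) (x' : C' ⊕ Option R) :
    MonitorTrans step' (.inr o) a c op x' ↔
      ∃ x, MonitorTrans step (.inr o) a c op x ∧ x' = Sum.map f id x := by
  constructor
  · intro ht
    cases ht with
    | watchDec => exact ⟨_, .watchDec, rfl⟩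
    | watchZero => exact ⟨_, .watchZero, rfl⟩
    | watchOther h1 h2 => exact ⟨_, .watchOther h1 h2, rfl⟩
    | sink => exact ⟨_, .sink, rfl⟩
  · rintro ⟨x, ht, rfl⟩
    cases ht with
    | watchDec => exact .watchDec
    | watchZero => exact .watchZero
    | watchOther h1 h2 => exact .watchOther h1 h2
    | sink => exact .sink

end Map

end CounterAct

/-! ### Invariance of universality under renaming. -/

namespace SAFA

variable {Q A H Q' A' H' D : Type*} [DecidableEq H] [DecidableEq H']

/-- Rename the set of a condition. -/
def Cond.map (e : H → H') : Cond H → Cond H'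
  | .mem i => .mem (e i)
  | .notMem i => .notMem (e i)

/-- Rename the set of an operation. -/
def Op.map (e : H → H') : Op H → Op H'
  | .skip => .skip
  | .ins i => .ins (e i)

/-- Rename the states, attributes and sets of an automaton. -/
def reindex (eQ : Q ≃ Q') (eA : A ≃ A') (eH : H ≃ H') (M : SAFA Q A H) : SAFA Q' A' H' where
  start := eQ M.start
  final := eQ '' M.final
  trans := {t | ∃ s ∈ M.trans,
    t = (eQ s.1, eA s.2.1, s.2.2.1.map eH, s.2.2.2.1.map eH, eQ s.2.2.2.2)}

theorem accepts_reindex {eQ : Q ≃ Q'} {eA : A ≃ A'} {eH : H ≃ H'} {M : SAFA Q A H} {q : Q}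
    {h : H → Set D} {w : List (A × D)} :
    (M.reindex eQ eA eH).Accepts (eQ q) (h ∘ eH.symm) (w.map (Prod.map eA id)) ↔
      M.Accepts q h w := by
  induction w generalizing q h with
  | nil => simp [accepts_nil, reindex]
  | cons x w ih =>
    obtain ⟨a, d⟩ := x
    have hc (c : Cond H) : (c.map eH).Holds (h ∘ eH.symm) d ↔ c.Holds h d := by
      cases c <;> simp [Cond.map, Cond.Holds]
    have hop (op : Op H) :
        (op.map eH).apply (h ∘ eH.symm) d = op.apply h d ∘ eH.symm := by
      cases op with
      | skip => rfl
      | ins i =>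
        simp only [Op.map, Op.apply]
        ext1 j
        simp [Function.update_apply, Equiv.symm_apply_eq]
    rw [List.map_cons, Prod.map_apply, accepts_cons, accepts_cons]
    constructor
    · rintro ⟨_, _, _, ⟨⟨q', a', c, op, r⟩, ht, heq⟩, hh, hacc⟩
      simp only [Prod.mk.injEq, EmbeddingLike.apply_eq_iff_eq] at heq
      obtain ⟨rfl, rfl, rfl, rfl, rfl⟩ := heq
      rw [id, hop, ih] at hacc
      exact ⟨c, op, r, ht, (hc c).1 hh, hacc⟩
    · rintro ⟨c, op, r, ht, hh, hacc⟩
      refine ⟨_, _, _, ⟨_, ht, rfl⟩, (hc c).2 hh, ?_⟩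
      rwa [id, hop, ih]

theorem isUniversal_reindex {eQ : Q ≃ Q'} {eA : A ≃ A'} {eH : H ≃ H'} {M : SAFA Q A H} :
    (M.reindex eQ eA eH).IsUniversal D ↔ M.IsUniversal D := by
  rw [isUniversal_iff, isUniversal_iff]
  have key (w : List (A × D)) := accepts_reindex (eQ := eQ) (eA := eA) (eH := eH) (M := M)
    (q := M.start) (h := fun _ => ∅) (w := w)
  have hsurj : Function.Surjective (List.map (Prod.map eA (id : D → D))) :=
    List.map_surjective_iff.2 (eA.surjective.prodMap Function.surjective_id)
  rw [hsurj.forall]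
  exact forall_congr' key

end SAFA

/-! ### Computing the descriptions of the monitors. -/

namespace CounterAct

open SAFA

variable {R σ : Type*}

/-- A numbering of the states of a monitor with a chain of length `n`, given a numbering of those
outside of the chain; the chain comes last. -/
def chainEquiv {N : ℕ} (e : σ ⊕ Option R ≃ Fin N) (n : ℕ) :
    (σ ⊕ Fin n) ⊕ Option R ≃ Fin (N + n) :=
  (((Equiv.sumAssoc σ (Fin n) (Option R)).trans
    ((Equiv.refl σ).sumCongr (Equiv.sumComm (Fin n) (Option R)))).trans
      (Equiv.sumAssoc σ (Option R) (Fin n)).symm).trans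
        ((e.sumCongr (Equiv.refl _)).trans finSumFinEquiv)

/-- The number of a chain position. -/
def chainCode (start N : ℕ) (i : ℕ) : ℕ := Nat.casesOn i start fun j => N + j

theorem chainEquiv_inl_inl {N : ℕ} (e : σ ⊕ Option R ≃ Fin N) (n : ℕ) (q : σ) :
    (chainEquiv e n (.inl (.inl q)) : ℕ) = e (.inl q) := by
  simp [chainEquiv]

theorem chainEquiv_inl_inr {N : ℕ} (e : σ ⊕ Option R ≃ Fin N) (n : ℕ) (i : Fin n) :
    (chainEquiv e n (.inl (.inr i)) : ℕ) = N + i := by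
  simp [chainEquiv]

theorem chainEquiv_inr {N : ℕ} (e : σ ⊕ Option R ≃ Fin N) (n : ℕ) (o : Option R) :
    (chainEquiv e n (.inr o) : ℕ) = e (.inr o) := by
  simp [chainEquiv]

theorem chainEquiv_chainPos {N : ℕ} (e : σ ⊕ Option R ≃ Fin N) (n : ℕ) (q₀ : σ)
    (i : Fin (n + 1)) :
    (chainEquiv e n (.inl (chainPos q₀ i)) : ℕ) = chainCode (e (.inl q₀)) N i := by
  cases i using Fin.cases with
  | zero => exact chainEquiv_inl_inl e n q₀
  | succ i => exact chainEquiv_inl_inr e n i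

theorem primrec_chainCode (start N : ℕ) : Primrec (chainCode start N) :=
  Primrec.nat_casesOn .id (.const start) (Primrec.nat_add.comp (.const N) .snd)

/-- The descriptions of automata which consist of a fixed part and a chain of varying length.
The transitions in the chain are given by patterns in which the target `none` stands for the next
position of the chain. -/
def chainDescription (N m k start : ℕ) (F : List ℕ) (T : List TransCode)
    (P : List (ℕ × (Bool × ℕ) × Option ℕ × Option ℕ)) (n : ℕ) : Code :=
  ((N + n, m, k), chainCode start N n, F ++ (List.range n).map (N + ·),
    T ++ (List.range n).flatMap fun i => P.map fun p =>
      (N + i, p.1, p.2.1, p.2.2.1, p.2.2.2.getD (chainCode start N i)))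

theorem primrec_chainDescription (N m k start : ℕ) (F : List ℕ) (T : List TransCode)
    (P : List (ℕ × (Bool × ℕ) × Option ℕ × Option ℕ)) :
    Primrec (chainDescription N m k start F T P) := by
  have h1 : Primrec fun n : ℕ => ((N + n, m, k) : ℕ × ℕ × ℕ) :=
    (Primrec.nat_add.comp (.const N) .id).pair (.const (m, k))
  have h2 : Primrec fun n => F ++ (List.range n).map (N + ·) :=
    Primrec.list_append.comp (.const F)
      (Primrec.list_map .list_range (Primrec.nat_add.comp (.const N) .snd))
  have h3 : Primrec₂ fun (i : ℕ) (p : ℕ × (Bool × ℕ) × Option ℕ × Option ℕ) =>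
      ((N + i, p.1, p.2.1, p.2.2.1, p.2.2.2.getD (chainCode start N i)) : TransCode) := by
    have hp : Primrec fun x : ℕ × ℕ × (Bool × ℕ) × Option ℕ × Option ℕ => x.2 := .snd
    have hp2 := Primrec.snd.comp hp
    have hp3 := Primrec.snd.comp hp2
    exact (Primrec.nat_add.comp (.const N) .fst).pair ((Primrec.fst.comp hp).pair
      ((Primrec.fst.comp hp2).pair ((Primrec.fst.comp hp3).pair
        (Primrec.option_getD.comp (Primrec.snd.comp hp3)
          ((primrec_chainCode start N).comp .fst)))))
  have h4 : Primrec fun n => T ++ (List.range n).flatMap fun i => P.map fun p =>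
      ((N + i, p.1, p.2.1, p.2.2.1, p.2.2.2.getD (chainCode start N i)) : TransCode) :=
    Primrec.list_append.comp (.const T) (Primrec.list_flatMap .list_range
      (Primrec.list_map (.const P) (h3.comp (Primrec.snd.comp .fst) .snd)))
  exact h1.pair ((primrec_chainCode start N).pair (h2.pair h4))

/-- Supplies the parts of a description that do not vary with `n`; as constants they may be chosen
noncomputably. -/
theorem exists_list_mem_iff {α β : Type*} [Finite α] (f : α → β) (p : α → Prop) :
    ∃ l : List β, ∀ y, y ∈ l ↔ ∃ x, p x ∧ f x = y := by
  classical
  cases nonempty_fintype α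
  exact ⟨((Finset.univ.filter p).image f).toList, by simp⟩

instance {H : Type*} [Finite H] : Finite (Cond H) :=
  .of_surjective (fun x : Bool × H => if x.1 then .mem x.2 else .notMem x.2) fun
    | .mem i => ⟨(true, i), rfl⟩
    | .notMem i => ⟨(false, i), rfl⟩

instance {H : Type*} [Finite H] : Finite (Op H) :=
  .of_surjective (fun x : Option H => x.elim .skip .ins) fun
    | .skip => ⟨none, rfl⟩
    | .ins i => ⟨some i, rfl⟩

/-- The monitors of the runs of a fixed control that start with `n` increments of a register have
descriptions that can be computed from `n`. -/
theorem exists_primrec_describes [DecidableEq R] [Finite R] [Finite σ]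
    (M : DFA (CounterAct R) σ) (r₀ : R) :
    ∃ f : ℕ → Code, Primrec f ∧ ∀ n, ∃ (n' m k : ℕ) (eQ : (σ ⊕ Fin n) ⊕ Option R ≃ Fin n')
      (eA : CounterAct R ≃ Fin m) (eH : MonitorSet R ≃ Fin k),
      Describes (f n) ((monitor (chainStep M r₀ n) (chainPos M.start (Fin.last n))
        (Sum.inl '' M.accept)).reindex eQ eA eH) := by
  classical
  cases nonempty_fintype R
  obtain ⟨N, ⟨e⟩⟩ := Finite.exists_equiv_fin (σ ⊕ Option R)
  obtain ⟨m, ⟨eA⟩⟩ := Finite.exists_equiv_fin (CounterAct R)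
  obtain ⟨k, ⟨eH⟩⟩ := Finite.exists_equiv_fin (MonitorSet R)
  let step₁ : σ → CounterAct R → Option σ := fun q a => some (M.step q a)
  -- A template for the chain: `true` stands for the current position and `false` for the one that
  -- follows it.
  let step₂ : Bool → CounterAct R → Option Bool := fun _ a =>
    if a = .inc r₀ then some false else none
  obtain ⟨F, hF⟩ := exists_list_mem_iff (fun x => (e x : ℕ))
    (fun x : σ ⊕ Option R => x ∈ (monitor step₁ M.start M.accept).final)
  obtain ⟨T, hT⟩ := exists_list_mem_iff
    (fun s : (σ ⊕ Option R) × CounterAct R × Cond (MonitorSet R) × Op (MonitorSet R) ×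
      (σ ⊕ Option R) => (((e s.1 : ℕ), (eA s.2.1 : ℕ), (s.2.2.1.map eH).code,
        (s.2.2.2.1.map eH).code, (e s.2.2.2.2 : ℕ)) : TransCode))
    (fun s => s ∈ (monitor step₁ M.start M.accept).trans)
  obtain ⟨P, hP⟩ := exists_list_mem_iff
    (fun s : CounterAct R × Cond (MonitorSet R) × Op (MonitorSet R) × (Bool ⊕ Option R) =>
      ((eA s.1 : ℕ), (s.2.1.map eH).code, (s.2.2.1.map eH).code,
        s.2.2.2.elim (fun _ => none) fun o => some (e (.inr o) : ℕ)))
    (fun s => MonitorTrans step₂ (.inl true) s.1 s.2.1 s.2.2.1 s.2.2.2)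
  refine ⟨chainDescription N m k (e (.inl M.start)) F T P, primrec_chainDescription .., fun n =>
    ⟨N + n, m, k, chainEquiv e n, eA, eH, F ++ (List.range n).map (N + ·),
      T ++ (List.range n).flatMap fun i => P.map fun p =>
        (N + i, p.1, p.2.1, p.2.2.1, p.2.2.2.getD (chainCode (e (.inl M.start)) N i)),
      ?_, fun q => ?_, fun t => ?_⟩⟩
  · simp [chainDescription, reindex, monitor, chainEquiv_chainPos]
  · rw [List.mem_append, hF]
    simp only [reindex, monitor, List.mem_map, List.mem_range, Set.mem_image, Set.mem_ofPred_eq]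
    constructor
    · rintro (⟨x, rfl | ⟨q', hq, rfl⟩, rfl⟩ | ⟨i, hi, rfl⟩)
      · exact ⟨_, ⟨_, .inl rfl, rfl⟩, chainEquiv_inr ..⟩
      · exact ⟨_, ⟨_, .inr ⟨.inl q', by simpa using hq, rfl⟩, rfl⟩, chainEquiv_inl_inl ..⟩
      -- Chain states are rejecting for the control, hence final in the monitor.
      · exact ⟨_, ⟨_, .inr ⟨.inr ⟨i, hi⟩, by simp, rfl⟩, rfl⟩, chainEquiv_inl_inr ..⟩
    · rintro ⟨_, ⟨x, rfl | ⟨q' | i, hq, rfl⟩, rfl⟩, rfl⟩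
      · exact .inl ⟨_, .inl rfl, (chainEquiv_inr ..).symm⟩
      · exact .inl ⟨_, .inr ⟨q', by simpa using hq, rfl⟩, (chainEquiv_inl_inl ..).symm⟩
      · exact .inr ⟨i, i.2, (chainEquiv_inl_inr ..).symm⟩
  · let next (i : Fin n) (b : Bool) : σ ⊕ Fin n :=
      if b then .inr i else chainPos M.start i.castSucc
    have hold (x : σ ⊕ Option R) : (chainEquiv e n (Sum.map .inl id x) : ℕ) = e x := by
      cases x
      exacts [chainEquiv_inl_inl .., chainEquiv_inr ..]
    have hnew (i : Fin n) (x : Bool ⊕ Option R) (a c op)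
        (hx : MonitorTrans step₂ (.inl true) a c op x) :
        (chainEquiv e n (Sum.map (next i) id x) : ℕ) = (x.elim (fun _ => none) fun o => some (e (.inr o) : ℕ)).getD
            (chainCode (e (.inl M.start)) N i) := by
      rcases x with (_ | _) | o
      · exact chainEquiv_chainPos e n M.start i.castSucc
      -- No move of the template leads to `true`, so reading every control target as the next
      -- position is harmless.
      · cases hx <;> simp [step₂] at *
      · exact chainEquiv_inr ..
    have hstep₁ (q : σ) (a : CounterAct R) :
      chainStep M r₀ n (.inl q) a = (step₁ q a).map .inl := rfl
    have hstep₂ (i : Fin n) (a : CounterAct R) :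
        chainStep M r₀ n (next i true) a =
          (step₂ true a).map (next i) := by
      by_cases ha : a = .inc r₀ <;> simp [chainStep, step₂, next, ha]
    have hmap₁ := fun q => monitorTrans_inl_map (R := R) (step := step₁)
      (step' := chainStep M r₀ n) (q := q) Sum.inl (hstep₁ q)
    have hmap₂ := fun i : Fin n => monitorTrans_inl_map (R := R) (step := step₂)
      (step' := chainStep M r₀ n) (q := true) (next i) (hstep₂ i)
    have hmap₃ := monitorTrans_inr_map (R := R) step₁ (step' := chainStep M r₀ n) Sum.inl
    rw [List.mem_append, hT, List.mem_flatMap]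
    constructor
    · rintro (⟨⟨x, a, c, op, y⟩, ht, rfl⟩ | ⟨i, hi, ht⟩)
      · refine ⟨_, ⟨⟨Sum.map .inl id x, a, c, op, Sum.map .inl id y⟩, ?_, rfl⟩, ?_⟩
        · cases x with
          | inl q => exact (hmap₁ q a c op _).2 ⟨y, ht, rfl⟩
          | inr o => exact (hmap₃ o a c op _).2 ⟨y, ht, rfl⟩
        · simp [transCode, hold]
      · obtain ⟨p, hp, rfl⟩ := List.mem_map.1 ht
        obtain ⟨⟨a, c, op, y⟩, ht', rfl⟩ := (hP p).1 hp
        rw [List.mem_range] at hi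
        refine ⟨_,
          ⟨⟨.inl (.inr ⟨i, hi⟩), a, c, op, Sum.map (next ⟨i, hi⟩) id y⟩, (hmap₂ ⟨i, hi⟩ a c op _).2 ⟨y, ht', rfl⟩, rfl⟩, ?_⟩
        simp [transCode, hnew _ _ _ _ _ ht', chainEquiv_inl_inr]
    · rintro ⟨_, ⟨⟨x, a, c, op, y⟩, ht, rfl⟩, rfl⟩
      rcases x with (q | i) | o
      · obtain ⟨y, ht', rfl⟩ := (hmap₁ q a c op _).1 ht
        exact .inl ⟨(.inl q, a, c, op, y), ht', by simp [transCode, hold, chainEquiv_inl_inl]⟩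
      · obtain ⟨y, ht', rfl⟩ := (hmap₂ i a c op _).1 ht
        refine .inr ⟨i, List.mem_range.2 i.2,
          List.mem_map.2 ⟨_, (hP _).2 ⟨⟨a, c, op, y⟩, ht', rfl⟩, ?_⟩⟩
        simp [transCode, hnew _ _ _ _ _ ht', chainEquiv_inl_inr]
      · obtain ⟨y, ht', rfl⟩ := (hmap₃ o a c op _).1 ht
        exact .inl ⟨(.inr o, a, c, op, y), ht', by simp [transCode, hold, chainEquiv_inr]⟩

end CounterAct

/-! ### The reduction from the halting problem. -/

theorem mainTheorem4 (D : Type*) [Countable D] [Infinite D] :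
    ¬ SAFA.UniversalityDecidable D := by
  rintro ⟨P, hP, h⟩
  -- A single partial recursive function whose domain is the halting problem on input `0`, so the
  -- control obtained below does not depend on the instance.
  let f : ℕ →. ℕ := fun c => (Denumerable.ofNat Nat.Partrec.Code c).eval 0
  have hf : Partrec f :=
    Nat.Partrec.Code.eval_part.comp (Computable.ofNat _) (Computable.const 0)
  obtain ⟨K, σ, _, M, hM⟩ := CounterAct.exists_dfa_of_partrec hf
  obtain ⟨g, hg, hdesc⟩ := CounterAct.exists_primrec_describes M 0
  have key (n : ℕ) : P (g n) ↔ ¬ (f n).Dom := by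
    obtain ⟨n', m, k, eQ, eA, eH, hd⟩ := hdesc n
    rw [h _ _ _ _ _ hd, hM]
    convert SAFA.isUniversal_reindex.trans
      (CounterAct.monitor_chainStep_isUniversal_iff (D := D) M 0 n)
  refine ComputablePred.halting_problem 0 ?_
  obtain ⟨p, hp, rfl⟩ := ComputablePred.computable_iff.1 hP
  have : ComputablePred fun c : Nat.Partrec.Code => ¬ (p (g (Encodable.encode c)) : Prop) :=
    .not (ComputablePred.computable_iff.2
      ⟨_, hp.comp (hg.to_comp.comp Computable.encode), rfl⟩)
  refine this.of_eq fun c => ?_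
  have := key (Encodable.encode c)
  simp only [f, Denumerable.ofNat_encode] at this
  exact (not_congr this).trans not_not
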